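/- For $N\ge 1$ let $G_N=\frac{1}{\sqrt{2N}}(X_N+\mathrm{i}Y_N)$ be an $N\times N$ complex Ginibre matrix, where $X_N$ and $Y_N$ are independent $N\times N$ real random matrices, each with independent and identically distributed standard Gaussian entries; all random variables live on one probability space. Let $b_N$ be a random vector in $\mathbb{C}^N$ that is independent of $G_N$ and almost surely nonzero. Let $\sigma\in(0,1)$, let $k\ge 0$ be a fixed integer, set $A_N=I+\sigma G_N$, and let $$\|r_N^{(k)}\|=\min_{p\in\mathbb{C}[z],\ \deg p<k}\|b_N-A_N\,p(A_N)\,b_N\|$$ (Euclidean norm, with $p=0$ allowed) be the residual norm at step $k$ of GMRES applied to the linear system $A_Nx=b_N$. Then $$\frac{\|r_N^{(k)}\|}{\|b_N\|}\longrightarrow\left(\frac{1-\sigma^2}{1-\sigma^{2+2k}}\right)^{1/2}\sigma^k\qquad\text{in probability as }N\to\infty.$$ -/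

import Mathlib

open MeasureTheory ProbabilityTheory Filter
open scoped Matrix Polynomial

/-- `G` is an `N × N` complex Ginibre matrix on `(Ω, P)`: `G = (2N)^{-1/2} (X + i Y)`, where `X` and
`Y` are independent real random matrices, each with i.i.d. standard Gaussian entries. -/
def IsGinibre {Ω : Type*} [MeasurableSpace Ω] (P : Measure Ω) {N : ℕ}
    (G : Ω → Matrix (Fin N) (Fin N) ℂ) : Prop :=
  ∃ X Y : Ω → Matrix (Fin N) (Fin N) ℝ,
    (∀ i j, HasLaw (fun ω => X ω i j) (gaussianReal 0 1) P) ∧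
    (∀ i j, HasLaw (fun ω => Y ω i j) (gaussianReal 0 1) P) ∧
    iIndepFun (fun (ij : Fin N × Fin N) ω => X ω ij.1 ij.2) P ∧
    iIndepFun (fun (ij : Fin N × Fin N) ω => Y ω ij.1 ij.2) P ∧
    IndepFun (fun ω i j => X ω i j) (fun ω i j => Y ω i j) P ∧
    ∀ ω i j, G ω i j = ((√(2 * N) : ℝ) : ℂ)⁻¹ * ((X ω i j : ℂ) + Complex.I * (Y ω i j : ℂ))

/-- The residual norms `‖b - A p(A) b‖` (Euclidean norm) of the approximations `p(A) b` to the
solution of `A x = b`, where `p` is a complex polynomial of degree less than `k`. -/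
def krylovResidualNorms {N : ℕ} (A : Matrix (Fin N) (Fin N) ℂ) (b : EuclideanSpace ℂ (Fin N))
    (k : ℕ) : Set ℝ :=
  {r | ∃ p : ℂ[X], p.degree < (k : WithBot ℕ) ∧
    r = ‖b - WithLp.toLp 2 (A *ᵥ (Polynomial.aeval A p *ᵥ b.ofLp))‖}

/-- The norm of the step `k` GMRES residual for `A x = b`. -/
noncomputable def gmresResidualNorm {N : ℕ} (A : Matrix (Fin N) (Fin N) ℂ)
    (b : EuclideanSpace ℂ (Fin N)) (k : ℕ) : ℝ :=
  sInf (krylovResidualNorms A b k)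

/-- The infimum that defines the GMRES residual norm is a minimum. -/
theorem gmresResidualNorm_isLeast {N : ℕ} (A : Matrix (Fin N) (Fin N) ℂ)
    (b : EuclideanSpace ℂ (Fin N)) (k : ℕ) :
    IsLeast (krylovResidualNorms A b k) (gmresResidualNorm A b k) := by
  let L : ℂ[X] →ₗ[ℂ] EuclideanSpace ℂ (Fin N) :=
    { toFun := fun p => WithLp.toLp 2 (A *ᵥ (Polynomial.aeval A p *ᵥ b.ofLp))
      map_add' := fun p q => by
        simp [map_add, Matrix.add_mulVec, Matrix.mulVec_add]
      map_smul' := fun c p => by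
        simp [map_smul, Matrix.smul_mulVec, Matrix.mulVec_smul] }
  let K : Submodule ℂ (EuclideanSpace ℂ (Fin N)) := (Polynomial.degreeLT ℂ k).map L
  have hne : (krylovResidualNorms A b k).Nonempty :=
    ⟨_, 0, by simp, rfl⟩
  have hbd : BddBelow (krylovResidualNorms A b k) :=
    ⟨0, by rintro _ ⟨p, -, rfl⟩; exact norm_nonneg _⟩
  have hmem : K.starProjection b ∈ K := Submodule.starProjection_apply_mem K b
  obtain ⟨p, hp, hpe⟩ := hmem
  have hpk : ‖b - K.starProjection b‖ ∈ krylovResidualNorms A b k :=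
    ⟨p, Polynomial.mem_degreeLT.1 hp, by rw [← hpe]; rfl⟩
  have hmin : ∀ r ∈ krylovResidualNorms A b k, ‖b - K.starProjection b‖ ≤ r := by
    rintro _ ⟨q, hq, rfl⟩
    rw [Submodule.starProjection_minimal]
    exact ciInf_le (f := fun x : K => ‖b - x‖) ⟨0, by rintro _ ⟨x, rfl⟩; exact norm_nonneg _⟩
      ⟨L q, q, Polynomial.mem_degreeLT.2 hq, rfl⟩
  have h : gmresResidualNorm A b k = ‖b - K.starProjection b‖ :=
    le_antisymm (csInf_le hbd hpk) (le_csInf hne hmin)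
  rw [h]
  exact ⟨hpk, hmin⟩

/-! Put `u = b / ‖b‖` and `t = -σ⁻¹`. A GMRES residual is `q(A) b` with `deg q ≤ k` and `q(0) = 1`.
Substituting `A = 1 + σ G` turns it into `∑ c_j G^j b` for `j ≤ k`, and the constraint becomes `∑
c_j t^j = 1` (`exists_krylov_coeff_of_poly`, `exists_poly_of_krylov_coeff`). If the vectors `G^j u`
were orthonormal, the squared relative residual would be the minimum of `∑ |c_j|²` under this
constraint. By Cauchy–Schwarz that is `1 / ∑ t^(2j)`, the square of the claimed limit.
`abs_gmresResidualNorm_sq_sub_le` shows that the error is at most the entrywise `ℓ¹` distance of the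
Gram matrix of the `G^j u` from the identity.

It remains to see that this Gram matrix tends to the identity in probability
(`tendstoInMeasure_krylov_gram`). Let `v_j` be the Arnoldi vectors. Given the first `j` steps, which
reveal `G` only on the span of `v_0, …, v_{j-1}`, `G` acts on the orthogonal complement like a fresh
Ginibre matrix (`lintegral_arnoldiResample`). As `v_j` lies in that complement, `⟨v_i, G v_j⟩` for
`i ≤ j` and `‖G v_j‖² - ‖v_j‖²` have second moments `O(1/N)`. By induction and Pythagoras `‖v_j‖ →
1`, the Hessenberg entries on and above the diagonal tend to `0`, and `G^m u` is asymptotically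
`v_m`.

The Arnoldi process is left unnormalised, and the projection onto a zero vector is zero, so
breakdown needs no separate case. Conditioning is expressed by an integral identity, and equality in
law is proved by characteristic functions. -/

/-! ### Projections onto lines -/

section LineProj

variable {n : Type*} [Fintype n]

/-- The orthogonal projection onto the line spanned by `p`; it is `0` if `p = 0`. -/
noncomputable def lineProj (p : n → ℂ) : Matrix n n ℂ :=
  (star p ⬝ᵥ p)⁻¹ • Matrix.vecMulVec p (star p)

lemma lineProj_mulVec (p x : n → ℂ) :
    lineProj p *ᵥ x = ((star p ⬝ᵥ p)⁻¹ * (star p ⬝ᵥ x)) • p := by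
  rw [lineProj, Matrix.smul_mulVec, Matrix.vecMulVec_mulVec]
  ext a
  simp [mul_comm, mul_assoc]

open scoped ComplexOrder in
lemma lineProj_mulVec_self (p : n → ℂ) : lineProj p *ᵥ p = p := by
  rw [lineProj_mulVec]
  by_cases h : star p ⬝ᵥ p = 0
  · rw [dotProduct_star_self_eq_zero.1 h]; simp
  · rw [inv_mul_cancel₀ h, one_smul]

lemma lineProj_isHermitian (p : n → ℂ) : (lineProj p).IsHermitian := by
  have h : star (star p ⬝ᵥ p) = star p ⬝ᵥ p := (Matrix.star_dotProduct p p).symm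
  rw [Matrix.IsHermitian, lineProj, Matrix.conjTranspose_smul, Matrix.conjTranspose_vecMulVec,
    star_star, star_inv₀, h]

lemma mul_lineProj_of_mulVec_eq_self {A : Matrix n n ℂ} {p : n → ℂ} (h : A *ᵥ p = p) :
    A * lineProj p = lineProj p := by
  rw [lineProj, Matrix.mul_smul, Matrix.mul_vecMulVec, h]

lemma mul_lineProj_of_mulVec_eq_zero {A : Matrix n n ℂ} {p : n → ℂ} (h : A *ᵥ p = 0) :
    A * lineProj p = 0 := by
  rw [lineProj, Matrix.mul_smul, Matrix.mul_vecMulVec, h]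
  simp

/-- The squared Euclidean norm. -/
noncomputable def normSqSum (x : n → ℂ) : ℝ := ∑ a, ‖x a‖ ^ 2

lemma normSqSum_nonneg (x : n → ℂ) : 0 ≤ normSqSum x :=
  Finset.sum_nonneg fun _ _ => by positivity

lemma star_dotProduct_self (x : n → ℂ) : star x ⬝ᵥ x = (normSqSum x : ℂ) := by
  simp only [dotProduct, normSqSum, Pi.star_apply, RCLike.star_def, Complex.ofReal_sum]
  exact Finset.sum_congr rfl fun a _ => by rw [Complex.conj_mul']; simp

end LineProj

/-! ### Algebra of the Arnoldi process -/

section Arnoldi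

variable {n : Type*} [Fintype n] [DecidableEq n]

/-- The unnormalised Arnoldi process of `G` started at `u`. At step `j` the first component is the
component of `G` times the previous vector that is orthogonal to all earlier vectors, and the second
component is the orthogonal projection onto the span of the earlier vectors. -/
noncomputable def arnoldi (G : Matrix n n ℂ) (u : n → ℂ) : ℕ → (n → ℂ) × Matrix n n ℂ
  | 0 => (u, 0)
  | j + 1 =>
    ((1 - ((arnoldi G u j).2 + lineProj (arnoldi G u j).1)) *ᵥ (G *ᵥ (arnoldi G u j).1),
      (arnoldi G u j).2 + lineProj (arnoldi G u j).1)

/-- The `j`-th vector of the Arnoldi process. -/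
noncomputable def arnoldiVec (G : Matrix n n ℂ) (u : n → ℂ) (j : ℕ) : n → ℂ := (arnoldi G u j).1

/-- The projection onto the span of the first `j` vectors of the Arnoldi process. -/
noncomputable def arnoldiProj (G : Matrix n n ℂ) (u : n → ℂ) (j : ℕ) : Matrix n n ℂ :=
  (arnoldi G u j).2

@[simp] lemma arnoldiVec_zero (G : Matrix n n ℂ) (u : n → ℂ) : arnoldiVec G u 0 = u := rfl

@[simp] lemma arnoldiProj_zero (G : Matrix n n ℂ) (u : n → ℂ) : arnoldiProj G u 0 = 0 := rfl

lemma arnoldiProj_succ (G : Matrix n n ℂ) (u : n → ℂ) (j : ℕ) :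
    arnoldiProj G u (j + 1) = arnoldiProj G u j + lineProj (arnoldiVec G u j) := rfl

lemma arnoldiVec_succ (G : Matrix n n ℂ) (u : n → ℂ) (j : ℕ) :
    arnoldiVec G u (j + 1) = (1 - arnoldiProj G u (j + 1)) *ᵥ (G *ᵥ arnoldiVec G u j) := rfl

lemma arnoldiProj_isHermitian (G : Matrix n n ℂ) (u : n → ℂ) (j : ℕ) :
    (arnoldiProj G u j).IsHermitian := by
  induction j with
  | zero => simp
  | succ j ih => exact ih.add (lineProj_isHermitian _)

lemma lineProj_mul_arnoldiProj {G : Matrix n n ℂ} {u : n → ℂ} {j : ℕ}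
    (h : arnoldiProj G u j *ᵥ arnoldiVec G u j = 0) :
    lineProj (arnoldiVec G u j) * arnoldiProj G u j = 0 := by
  have := congrArg Matrix.conjTranspose (mul_lineProj_of_mulVec_eq_zero h)
  rwa [Matrix.conjTranspose_mul, (lineProj_isHermitian _).eq, (arnoldiProj_isHermitian G u j).eq,
    Matrix.conjTranspose_zero] at this

/-- The two claims need a joint induction: adding a line keeps the projection idempotent because the
new vector is orthogonal to the old span, and idempotence in turn makes the next vector orthogonal.
-/
lemma arnoldi_idempotent_orthogonal (G : Matrix n n ℂ) (u : n → ℂ) (j : ℕ) :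
    arnoldiProj G u j * arnoldiProj G u j = arnoldiProj G u j ∧
      arnoldiProj G u j *ᵥ arnoldiVec G u j = 0 := by
  induction j with
  | zero => simp
  | succ j ih =>
    have h : arnoldiProj G u (j + 1) * arnoldiProj G u (j + 1) = arnoldiProj G u (j + 1) := by
      rw [arnoldiProj_succ, mul_add, add_mul, add_mul, ih.1, lineProj_mul_arnoldiProj ih.2,
        mul_lineProj_of_mulVec_eq_zero ih.2,
        mul_lineProj_of_mulVec_eq_self (lineProj_mulVec_self _)]
      simp
    refine ⟨h, ?_⟩
    rw [arnoldiVec_succ, Matrix.mulVec_mulVec, mul_sub, h]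
    simp

lemma arnoldiProj_mul_self (G : Matrix n n ℂ) (u : n → ℂ) (j : ℕ) :
    arnoldiProj G u j * arnoldiProj G u j = arnoldiProj G u j :=
  (arnoldi_idempotent_orthogonal G u j).1

lemma arnoldiProj_mulVec_arnoldiVec (G : Matrix n n ℂ) (u : n → ℂ) (j : ℕ) :
    arnoldiProj G u j *ᵥ arnoldiVec G u j = 0 :=
  (arnoldi_idempotent_orthogonal G u j).2

lemma arnoldiProj_succ_mul (G : Matrix n n ℂ) (u : n → ℂ) (j : ℕ) :
    arnoldiProj G u (j + 1) * arnoldiProj G u j = arnoldiProj G u j := by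
  rw [arnoldiProj_succ, add_mul, arnoldiProj_mul_self,
    lineProj_mul_arnoldiProj (arnoldiProj_mulVec_arnoldiVec G u j), add_zero]

lemma arnoldiProj_mulVec_of_lt (G : Matrix n n ℂ) (u : n → ℂ) {i j : ℕ} (h : i < j) :
    arnoldiProj G u j *ᵥ arnoldiVec G u i = arnoldiVec G u i := by
  induction j, h using Nat.le_induction with
  | base =>
    rw [arnoldiProj_succ, Matrix.add_mulVec, arnoldiProj_mulVec_arnoldiVec, lineProj_mulVec_self,
      zero_add]
  | succ j _ ih => rw [← ih, Matrix.mulVec_mulVec, arnoldiProj_succ_mul]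

lemma arnoldiVec_orthogonal_of_lt (G : Matrix n n ℂ) (u : n → ℂ) {i j : ℕ} (h : i < j) :
    star (arnoldiVec G u i) ⬝ᵥ arnoldiVec G u j = 0 := by
  rw [← arnoldiProj_mulVec_of_lt G u h, Matrix.star_mulVec, ← Matrix.dotProduct_mulVec,
    (arnoldiProj_isHermitian G u j).eq, arnoldiProj_mulVec_arnoldiVec, dotProduct_zero]

lemma arnoldiVec_orthogonal (G : Matrix n n ℂ) (u : n → ℂ) {i j : ℕ} (h : i ≠ j) :
    star (arnoldiVec G u i) ⬝ᵥ arnoldiVec G u j = 0 := by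
  rcases h.lt_or_gt with h | h
  · exact arnoldiVec_orthogonal_of_lt G u h
  · have := congrArg star (arnoldiVec_orthogonal_of_lt G u h)
    rwa [← Matrix.star_dotProduct, star_zero] at this

lemma arnoldiProj_eq_sum (G : Matrix n n ℂ) (u : n → ℂ) (j : ℕ) :
    arnoldiProj G u j = ∑ i ∈ Finset.range j, lineProj (arnoldiVec G u i) := by
  induction j with
  | zero => simp
  | succ j ih => rw [arnoldiProj_succ, ih, Finset.sum_range_succ]

/-- The entry `(i, j)` of the Hessenberg matrix of the Arnoldi process. -/
noncomputable def arnoldiCoeff (G : Matrix n n ℂ) (u : n → ℂ) (i j : ℕ) : ℂ :=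
  (star (arnoldiVec G u i) ⬝ᵥ arnoldiVec G u i)⁻¹ *
    (star (arnoldiVec G u i) ⬝ᵥ (G *ᵥ arnoldiVec G u j))

lemma mulVec_arnoldiVec (G : Matrix n n ℂ) (u : n → ℂ) (j : ℕ) :
    G *ᵥ arnoldiVec G u j = arnoldiVec G u (j + 1) +
      ∑ i ∈ Finset.range (j + 1), arnoldiCoeff G u i j • arnoldiVec G u i := by
  have h : arnoldiProj G u (j + 1) *ᵥ (G *ᵥ arnoldiVec G u j) =
      ∑ i ∈ Finset.range (j + 1), arnoldiCoeff G u i j • arnoldiVec G u i := by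
    rw [arnoldiProj_eq_sum, Matrix.sum_mulVec]
    exact Finset.sum_congr rfl fun i _ => lineProj_mulVec _ _
  rw [arnoldiVec_succ, ← h, Matrix.sub_mulVec, Matrix.one_mulVec, sub_add_cancel]

/-- Pythagoras for `mulVec_arnoldiVec`. It transfers control of `‖G v_j‖` and of the Hessenberg
entries to `‖v_{j+1}‖`. -/
lemma star_dotProduct_mulVec_arnoldiVec (G : Matrix n n ℂ) (u : n → ℂ) (j : ℕ) :
    star (G *ᵥ arnoldiVec G u j) ⬝ᵥ (G *ᵥ arnoldiVec G u j) =
      star (arnoldiVec G u (j + 1)) ⬝ᵥ arnoldiVec G u (j + 1) +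
        ∑ i ∈ Finset.range (j + 1), arnoldiCoeff G u i j *
          star (star (arnoldiVec G u i) ⬝ᵥ (G *ᵥ arnoldiVec G u j)) := by
  have h1 : star (G *ᵥ arnoldiVec G u j) ⬝ᵥ arnoldiVec G u (j + 1) =
      star (arnoldiVec G u (j + 1)) ⬝ᵥ arnoldiVec G u (j + 1) := by
    conv_lhs => rw [mulVec_arnoldiVec G u j]
    rw [star_add, add_dotProduct, star_sum, sum_dotProduct]
    rw [Finset.sum_eq_zero, add_zero]
    intro i hi
    rw [star_smul, smul_dotProduct, arnoldiVec_orthogonal_of_lt G u (Finset.mem_range.1 hi),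
      smul_zero]
  conv_lhs => enter [2]; rw [mulVec_arnoldiVec G u j]
  rw [dotProduct_add, h1, dotProduct_sum]
  congr 1
  refine Finset.sum_congr rfl fun i _ => ?_
  rw [dotProduct_smul, smul_eq_mul, Matrix.star_dotProduct]

/-- The Arnoldi process up to step `j` depends on `G` only through its action on the span of the
first `j` vectors. -/
lemma arnoldi_congr {G G' : Matrix n n ℂ} {u : n → ℂ} {j : ℕ}
    (h : G' * arnoldiProj G u j = G * arnoldiProj G u j) {i : ℕ} (hij : i ≤ j) :
    arnoldi G' u i = arnoldi G u i := by
  induction i with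
  | zero => rfl
  | succ i ih =>
    have ih := ih (by omega)
    have hi : G' *ᵥ (arnoldi G u i).1 = G *ᵥ (arnoldi G u i).1 := by
      have := arnoldiProj_mulVec_of_lt G u (i := i) (j := j) (by omega)
      rw [arnoldiVec] at this
      rw [← this, Matrix.mulVec_mulVec, Matrix.mulVec_mulVec, h]
    simp only [arnoldi, ih, hi]

lemma normSqSum_arnoldiVec_succ_le (G : Matrix n n ℂ) (u : n → ℂ) (j : ℕ) :
    normSqSum (arnoldiVec G u (j + 1)) ≤ normSqSum (G *ᵥ arnoldiVec G u j) := by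
  have h := congrArg Complex.re (star_dotProduct_mulVec_arnoldiVec G u j)
  rw [star_dotProduct_self, star_dotProduct_self, Complex.add_re, Complex.ofReal_re,
    Complex.ofReal_re, Complex.re_sum] at h
  rw [h, le_add_iff_nonneg_right]
  refine Finset.sum_nonneg fun i _ => ?_
  rw [arnoldiCoeff, star_dotProduct_self, mul_assoc, RCLike.star_def, Complex.mul_conj,
    ← Complex.ofReal_inv, ← Complex.ofReal_mul, Complex.ofReal_re]
  exact mul_nonneg (inv_nonneg.2 (normSqSum_nonneg _)) (Complex.normSq_nonneg _)

end Arnoldi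

/-! ### Characteristic functions of measures on complex matrices -/

section MatrixMeasure

variable {n : Type*} [Fintype n]

noncomputable instance matrixMeasurableSpace : MeasurableSpace (Matrix n n ℂ) :=
  inferInstanceAs (MeasurableSpace (n → n → ℂ))

instance matrixBorelSpace : BorelSpace (Matrix n n ℂ) :=
  inferInstanceAs (BorelSpace (n → n → ℂ))

instance matrixSecondCountableTopology : SecondCountableTopology (Matrix n n ℂ) :=
  inferInstanceAs (SecondCountableTopology (n → n → ℂ))

/-- The real inner product of two complex matrices. -/
noncomputable def frobInner (S T : Matrix n n ℂ) : ℝ := (Matrix.trace (Sᴴ * T)).re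

lemma frobInner_eq_sum (S T : Matrix n n ℂ) :
    frobInner S T = ∑ a, ∑ b, ((S a b).re * (T a b).re + (S a b).im * (T a b).im) := by
  rw [Finset.sum_comm]
  simp [frobInner, Matrix.trace, Matrix.mul_apply]

lemma continuous_frobInner (S : Matrix n n ℂ) : Continuous (frobInner S) := by
  unfold frobInner
  fun_prop

lemma frobInner_mul_right (R S T : Matrix n n ℂ) :
    frobInner S (T * R) = frobInner (S * Rᴴ) T := by
  rw [frobInner, frobInner, Matrix.conjTranspose_mul, Matrix.conjTranspose_conjTranspose,
    ← Matrix.mul_assoc, Matrix.trace_mul_comm, Matrix.mul_assoc]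

lemma frobInner_add_right (S T T' : Matrix n n ℂ) :
    frobInner S (T + T') = frobInner S T + frobInner S T' := by
  simp [frobInner, mul_add]

lemma exists_frobInner_eq [DecidableEq n] (L : StrongDual ℝ (n → n → ℂ)) :
    ∃ T : Matrix n n ℂ, ∀ G : Matrix n n ℂ, L G = frobInner T G := by
  let M : Matrix n n ℂ →ₗ[ℝ] ℝ := L.toLinearMap
  -- `frobInner` pairs real parts with real parts and imaginary parts with imaginary parts, so the
  -- entries of `T` are read off from the values at `E_ab` and `i E_ab`.
  refine ⟨Matrix.of fun a b => (M (Matrix.single a b 1) : ℂ) + (M (Matrix.single a b Complex.I)) *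
    Complex.I, fun G => ?_⟩
  have h : L G = M G := rfl
  have h2 (a b) : Matrix.single a b (G a b) = (G a b).re • Matrix.single a b (1 : ℂ) +
      (G a b).im • Matrix.single a b Complex.I := by
    rw [Matrix.smul_single, Matrix.smul_single, ← Matrix.single_add]
    congr 1
    simp [Complex.real_smul, Complex.re_add_im]
  rw [h, frobInner_eq_sum]
  conv_lhs => rw [Matrix.matrix_eq_sum_single G]
  simp only [map_sum, h2, map_add, map_smul]
  simp [mul_comm]

/-- A finite measure on complex matrices is determined by its characteristic function. -/
lemma measure_ext_of_frobInner [DecidableEq n] {μ ν : Measure (Matrix n n ℂ)} [IsFiniteMeasure μ]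
    [IsFiniteMeasure ν]
    (h : ∀ T, ∫ G, Complex.exp (frobInner T G * Complex.I) ∂μ =
      ∫ G, Complex.exp (frobInner T G * Complex.I) ∂ν) : μ = ν := by
  let μ' : Measure (n → n → ℂ) := μ
  let ν' : Measure (n → n → ℂ) := ν
  have : IsFiniteMeasure μ' := ‹IsFiniteMeasure μ›
  have : IsFiniteMeasure ν' := ‹IsFiniteMeasure ν›
  have : μ' = ν' := by
    refine Measure.ext_of_charFunDual ?_
    ext L
    obtain ⟨T, hT⟩ := exists_frobInner_eq L
    rw [charFunDual_apply, charFunDual_apply]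
    have e (G : n → n → ℂ) : L G = frobInner T G := hT G
    simp only [e]
    exact h T
  exact this

end MatrixMeasure

/-! ### The Ginibre law and its invariances -/

section Ginibre

/-- The matrix `(2N)^{-1/2} (X + i Y)` built from its real and imaginary parts. -/
noncomputable def ginibreOfReal (N : ℕ) (z : (Fin N × Fin N → ℝ) × (Fin N × Fin N → ℝ)) :
    Matrix (Fin N) (Fin N) ℂ :=
  fun i j => ((√(2 * N) : ℝ) : ℂ)⁻¹ * ((z.1 (i, j) : ℂ) + Complex.I * (z.2 (i, j) : ℂ))

/-- The standard Gaussian measure on `ℝ^ι`. -/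
noncomputable def stdGaussianPi (ι : Type*) [Fintype ι] : Measure (ι → ℝ) :=
  Measure.pi fun _ => gaussianReal 0 1

instance (ι : Type*) [Fintype ι] : IsProbabilityMeasure (stdGaussianPi ι) := by
  unfold stdGaussianPi; infer_instance

/-- The law of the `N × N` complex Ginibre matrix. -/
noncomputable def ginibreLaw (N : ℕ) : Measure (Matrix (Fin N) (Fin N) ℂ) :=
  ((stdGaussianPi (Fin N × Fin N)).prod (stdGaussianPi (Fin N × Fin N))).map (ginibreOfReal N)

lemma measurable_ginibreOfReal (N : ℕ) : Measurable (ginibreOfReal N) := by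
  refine measurable_pi_iff.2 fun i => measurable_pi_iff.2 fun j => ?_
  unfold ginibreOfReal
  fun_prop

instance (N : ℕ) : IsProbabilityMeasure (ginibreLaw N) :=
  Measure.isProbabilityMeasure_map (measurable_ginibreOfReal N).aemeasurable

lemma integral_exp_stdGaussianPi {ι : Type*} [Fintype ι] (s : ι → ℝ) :
    ∫ x, Complex.exp ((∑ e, s e * x e : ℝ) * Complex.I) ∂(stdGaussianPi ι) =
      Complex.exp (-(∑ e, s e ^ 2 : ℝ) / 2) := by
  have h (x : ι → ℝ) : Complex.exp ((∑ e, s e * x e : ℝ) * Complex.I) =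
      ∏ e, Complex.exp (s e * x e * Complex.I) := by
    rw [← Complex.exp_sum, Complex.ofReal_sum, Finset.sum_mul]
    simp
  simp only [h]
  rw [stdGaussianPi, integral_fintype_prod_eq_prod (f := fun e (x : ℝ) =>
    Complex.exp (s e * x * Complex.I))]
  simp only [← charFun_apply_real, charFun_gaussianReal]
  rw [← Complex.exp_sum]
  congr 1
  simp [Finset.sum_div, neg_div]

/-- The characteristic function depends on `T` only through its Frobenius norm; every invariance of
the law used below comes from this. -/
lemma integral_exp_ginibreLaw {N : ℕ} (T : Matrix (Fin N) (Fin N) ℂ) :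
    ∫ G, Complex.exp (frobInner T G * Complex.I) ∂(ginibreLaw N) =
      Complex.exp (-(((2 * (√(2 * N)) ^ 2)⁻¹ * frobInner T T : ℝ))) := by
  rw [ginibreLaw, integral_map (measurable_ginibreOfReal N).aemeasurable]
  swap
  · have := continuous_frobInner T
    exact Continuous.aestronglyMeasurable (by fun_prop)
  set s := (√(2 * N))⁻¹ with hs
  have h (z : (Fin N × Fin N → ℝ) × (Fin N × Fin N → ℝ)) :
      Complex.exp (frobInner T (ginibreOfReal N z) * Complex.I) =
      Complex.exp ((∑ e : Fin N × Fin N, (s * (T e.1 e.2).re) * z.1 e : ℝ) * Complex.I) *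
      Complex.exp ((∑ e : Fin N × Fin N, (s * (T e.1 e.2).im) * z.2 e : ℝ) * Complex.I) := by
    rw [← Complex.exp_add, ← add_mul, ← Complex.ofReal_add, ← Finset.sum_add_distrib,
      frobInner_eq_sum, ← Fintype.sum_prod_type']
    congr 3
    refine Finset.sum_congr rfl fun e _ => ?_
    simp only [ginibreOfReal, ← Complex.ofReal_inv, ← hs]
    simp
    ring
  simp only [h]
  rw [integral_prod_mul
      (fun x : Fin N × Fin N → ℝ =>
        Complex.exp ((∑ e : Fin N × Fin N, (s * (T e.1 e.2).re) * x e : ℝ) * Complex.I))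
      (fun x : Fin N × Fin N → ℝ =>
        Complex.exp ((∑ e : Fin N × Fin N, (s * (T e.1 e.2).im) * x e : ℝ) * Complex.I)),
    integral_exp_stdGaussianPi, integral_exp_stdGaussianPi, ← Complex.exp_add, ← add_div,
    ← neg_add, ← Complex.ofReal_add, ← Finset.sum_add_distrib, frobInner_eq_sum,
    ← Fintype.sum_prod_type']
  rw [← Complex.ofReal_neg, ← Complex.ofReal_neg, ← Complex.ofReal_ofNat, ← Complex.ofReal_div]
  congr 2
  rw [mul_inv, ← inv_pow, ← hs, neg_div, Finset.sum_div, Finset.mul_sum]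
  congr 1
  refine Finset.sum_congr rfl fun e _ => ?_
  ring

/-- Real-linear images of independent Ginibre matrices have the same law as soon as the sizes of
their adjoints match. -/
lemma map_ginibreLaw_prod_eq {N : ℕ}
    {S₁ S₂ S₃ S₁' S₂' S₃' : Matrix (Fin N) (Fin N) ℂ → Matrix (Fin N) (Fin N) ℂ}
    (m₁ : Measurable S₁) (m₂ : Measurable S₂) (m₃ : Measurable S₃)
    (h₁ : ∀ T G, frobInner T (S₁ G) = frobInner (S₁' T) G)
    (h₂ : ∀ T G, frobInner T (S₂ G) = frobInner (S₂' T) G)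
    (h₃ : ∀ T G, frobInner T (S₃ G) = frobInner (S₃' T) G)
    (h : ∀ T, frobInner (S₁' T) (S₁' T) + frobInner (S₂' T) (S₂' T) =
      frobInner (S₃' T) (S₃' T)) :
    ((ginibreLaw N).prod (ginibreLaw N)).map (fun G => S₁ G.1 + S₂ G.2) =
      (ginibreLaw N).map S₃ := by
  have m : Measurable fun G : Matrix (Fin N) (Fin N) ℂ × Matrix (Fin N) (Fin N) ℂ =>
      S₁ G.1 + S₂ G.2 := by fun_prop
  have := Measure.isProbabilityMeasure_map (μ := (ginibreLaw N).prod (ginibreLaw N))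
    m.aemeasurable
  have := Measure.isProbabilityMeasure_map (μ := ginibreLaw N) m₃.aemeasurable
  refine measure_ext_of_frobInner fun T => ?_
  have hT := continuous_frobInner T
  rw [integral_map m.aemeasurable (Continuous.aestronglyMeasurable (by fun_prop)),
    integral_map m₃.aemeasurable (Continuous.aestronglyMeasurable (by fun_prop))]
  -- The characteristic function of an image at `T` is that of the Ginibre law at the adjoint
  -- applied to `T`.
  simp only [frobInner_add_right, h₁, h₂, h₃, integral_exp_ginibreLaw, ← h, Complex.ofReal_add,
    add_mul, Complex.exp_add]
  rw [integral_prod_mul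
      (fun G : Matrix (Fin N) (Fin N) ℂ => Complex.exp (frobInner (S₁' T) G * Complex.I))
      (fun G : Matrix (Fin N) (Fin N) ℂ => Complex.exp (frobInner (S₂' T) G * Complex.I)),
    integral_exp_ginibreLaw, integral_exp_ginibreLaw, ← Complex.exp_add]
  congr 1
  push_cast
  ring

/-- Two real-linear images of a Ginibre matrix have the same law as soon as the sizes of their
adjoints match. -/
lemma map_ginibreLaw_eq {N : ℕ}
    {S₁ S₃ S₁' S₃' : Matrix (Fin N) (Fin N) ℂ → Matrix (Fin N) (Fin N) ℂ}
    (m₁ : Measurable S₁) (m₃ : Measurable S₃)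
    (h₁ : ∀ T G, frobInner T (S₁ G) = frobInner (S₁' T) G)
    (h₃ : ∀ T G, frobInner T (S₃ G) = frobInner (S₃' T) G)
    (h : ∀ T, frobInner (S₁' T) (S₁' T) = frobInner (S₃' T) (S₃' T)) :
    (ginibreLaw N).map S₁ = (ginibreLaw N).map S₃ := by
  rw [← map_ginibreLaw_prod_eq (S₂ := fun _ => 0) (S₂' := fun _ => 0) m₁ measurable_const m₃ h₁
    (by simp [frobInner]) h₃ (by simpa [frobInner] using h)]
  simp only [add_zero]
  conv_rhs => rw [← Function.comp_def, ← Measure.map_map m₁ measurable_fst]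
  simp

/-- The right multiplications by two complementary projections, applied to independent Ginibre
matrices, add up to the right multiplication of a single Ginibre matrix. -/
lemma lintegral_ginibreLaw_mul_add_mul {N : ℕ} {A B : Matrix (Fin N) (Fin N) ℂ}
    (hA : A.IsHermitian) (hB : B.IsHermitian) (hAB : A * B = 0)
    {f : Matrix (Fin N) (Fin N) ℂ → ENNReal} (hf : Measurable f) :
    ∫⁻ G, ∫⁻ G', f (G * A + G' * B) ∂(ginibreLaw N) ∂(ginibreLaw N) =
      ∫⁻ G, f (G * (A + B)) ∂(ginibreLaw N) := by
  have hBA : B * A = 0 := by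
    simpa [Matrix.conjTranspose_mul, hA.eq, hB.eq] using congrArg Matrix.conjTranspose hAB
  have key := map_ginibreLaw_prod_eq (N := N) (S₁ := (· * A)) (S₂ := (· * B)) (S₃ := (· * (A + B)))
    (S₁' := (· * A)) (S₂' := (· * B)) (S₃' := (· * (A + B))) (by fun_prop) (by fun_prop)
    (by fun_prop) (fun T G => by rw [frobInner_mul_right, hA.eq])
    (fun T G => by rw [frobInner_mul_right, hB.eq])
    (fun T G => by rw [frobInner_mul_right, (hA.add hB).eq])
    -- `‖T A‖² + ‖T B‖² = ‖T (A + B)‖²`, since the cross terms contain `A B = 0` or `B A = 0`.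
    (fun T => by
      rw [frobInner_mul_right, frobInner_mul_right, frobInner_mul_right, hA.eq, hB.eq,
        (hA.add hB).eq, mul_assoc, mul_assoc, mul_assoc, mul_add (A + B), add_mul, add_mul, hAB,
        hBA, add_zero, zero_add, mul_add]
      simp [frobInner, add_mul])
  rw [← lintegral_map (f := f) (g := (· * (A + B))) hf (by fun_prop), ← key,
    lintegral_map hf (by fun_prop), lintegral_prod _ (by fun_prop)]

end Ginibre

/-! ### Moments of a Ginibre matrix applied to fixed vectors -/

section Moments

lemma frobInner_eq_re_sum {n : Type*} [Fintype n] (S T : Matrix n n ℂ) :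
    frobInner S T = (∑ a, ∑ b, star (S a b) * T a b).re := by
  rw [frobInner_eq_sum]
  simp

lemma frobInner_self {n : Type*} [Fintype n] (S : Matrix n n ℂ) :
    frobInner S S = ∑ a, ∑ b, ‖S a b‖ ^ 2 := by
  rw [frobInner_eq_sum]
  refine Finset.sum_congr rfl fun a _ => Finset.sum_congr rfl fun b _ => ?_
  rw [Complex.sq_norm, Complex.normSq_apply]

@[fun_prop]
lemma Measurable.matrix_mulVec {α n : Type*} [MeasurableSpace α] [Fintype n]
    {A : α → Matrix n n ℂ} {v : α → n → ℂ} (hA : Measurable A) (hv : Measurable v) :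
    Measurable fun x => A x *ᵥ v x := by
  refine measurable_pi_iff.2 fun i => ?_
  simp only [Matrix.mulVec, dotProduct]
  exact Finset.measurable_sum _ fun j _ =>
    ((measurable_pi_apply j).comp ((measurable_pi_apply i).comp hA)).mul
      ((measurable_pi_apply j).comp hv)

@[fun_prop]
lemma Measurable.star_dotProduct {α n : Type*} [MeasurableSpace α] [Fintype n]
    {v w : α → n → ℂ} (hv : Measurable v) (hw : Measurable w) :
    Measurable fun x => star (v x) ⬝ᵥ w x := by
  simp only [dotProduct, Pi.star_apply, RCLike.star_def]
  exact Finset.measurable_sum _ fun j _ =>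
    (Complex.continuous_conj.measurable.comp ((measurable_pi_apply j).comp hv)).mul
      ((measurable_pi_apply j).comp hw)

@[fun_prop]
lemma Measurable.normSqSum {α n : Type*} [MeasurableSpace α] [Fintype n]
    {v : α → n → ℂ} (hv : Measurable v) : Measurable fun x => normSqSum (v x) := by
  simp only [_root_.normSqSum]
  exact Finset.measurable_sum _ fun j _ => ((measurable_pi_apply j).comp hv).norm.pow_const 2

lemma measurable_matrix_apply {n : Type*} [Fintype n] (i j : n) :
    Measurable fun G : Matrix n n ℂ => G i j :=
  (measurable_pi_apply j).comp (measurable_pi_apply i)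

lemma measurable_matrix_iff {α n : Type*} [MeasurableSpace α] [Fintype n]
    {A : α → Matrix n n ℂ} : Measurable A ↔ ∀ i j, Measurable fun x => A x i j :=
  measurable_pi_iff.trans (forall_congr' fun _ => measurable_pi_iff)

lemma integrable_sq_gaussianReal : Integrable (fun x : ℝ => x ^ 2) (gaussianReal 0 1) :=
  (memLp_id_gaussianReal' (μ := 0) (v := 1) 2 (by simp)).integrable_sq

lemma integral_sq_gaussianReal : ∫ x, x ^ 2 ∂(gaussianReal 0 1) = 1 := by
  have hv := variance_id_gaussianReal (μ := 0) (v := 1)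
  rw [variance_of_integral_eq_zero aemeasurable_id (by simp)] at hv
  simpa using hv

lemma lintegral_sq_gaussianReal : ∫⁻ x, ENNReal.ofReal (x ^ 2) ∂(gaussianReal 0 1) = 1 := by
  rw [← ofReal_integral_eq_lintegral_ofReal integrable_sq_gaussianReal
    (ae_of_all _ fun x => sq_nonneg _), integral_sq_gaussianReal, ENNReal.ofReal_one]

lemma lintegral_sq_stdGaussianPi {ι : Type*} [Fintype ι] (e : ι) :
    ∫⁻ x, ENNReal.ofReal (x e ^ 2) ∂(stdGaussianPi ι) = 1 := by
  rw [← lintegral_sq_gaussianReal]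
  exact (measurePreserving_eval (fun _ : ι => gaussianReal 0 1) e).lintegral_comp
    (f := fun x => ENNReal.ofReal (x ^ 2)) (by fun_prop)

lemma memLp_sq_sub_one_gaussianReal :
    MemLp (fun x : ℝ => x ^ 2 - 1) 2 (gaussianReal 0 1) := by
  have hm : MemLp id 4 (gaussianReal 0 1) := memLp_id_gaussianReal' 4 (by simp)
  refine MemLp.sub ?_ (memLp_const 1)
  have : ENNReal.HolderTriple 4 4 2 := ⟨by
    rw [← ENNReal.toReal_eq_toReal_iff' (by simp) (by simp)]
    rw [ENNReal.toReal_add (by simp) (by simp)]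
    norm_num⟩
  have := hm.mul (r := 2) hm
  simpa [sq, id, Pi.mul_def] using this

lemma lintegral_sum_sq_sub_one_sq {ι κ : Type*} [Fintype ι] [Fintype κ] (g : κ → ι)
    (hg : Function.Injective g) :
    ∫⁻ x, ENNReal.ofReal ((∑ a, (x (g a) ^ 2 - 1)) ^ 2) ∂(stdGaussianPi ι) =
      ENNReal.ofReal (Fintype.card κ * Var[fun x : ℝ => x ^ 2 - 1; gaussianReal 0 1]) := by
  classical
  have hm := memLp_sq_sub_one_gaussianReal
  have h0 : ∫ x, (x ^ 2 - 1) ∂(gaussianReal 0 1) = 0 := by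
    rw [integral_sub integrable_sq_gaussianReal (integrable_const _), integral_sq_gaussianReal]
    simp
  have hmp (e : ι) := measurePreserving_eval (fun _ : ι => gaussianReal 0 1) e
  have hma (a : κ) : MemLp (fun x : ι → ℝ => x (g a) ^ 2 - 1) 2 (stdGaussianPi ι) :=
    hm.comp_measurePreserving (hmp (g a))
  have hsum : MemLp (fun x : ι → ℝ => ∑ a, (x (g a) ^ 2 - 1)) 2 (stdGaussianPi ι) :=
    memLp_finsetSum _ fun a _ => hma a
  have hs0 : ∫ x, ∑ a, (x (g a) ^ 2 - 1) ∂(stdGaussianPi ι) = 0 := by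
    rw [integral_finsetSum _ fun a _ => (hma a).integrable (by norm_num)]
    refine Finset.sum_eq_zero fun a _ => ?_
    rw [← h0, ← (hmp (g a)).map_eq, integral_map (hmp _).measurable.aemeasurable
      (Continuous.aestronglyMeasurable (by fun_prop))]
    rfl
  have hvar : Var[fun x : ι → ℝ => ∑ a, (x (g a) ^ 2 - 1); stdGaussianPi ι] =
      Fintype.card κ * Var[fun x : ℝ => x ^ 2 - 1; gaussianReal 0 1] := by
    -- The sum over `κ` is extended by zero to all coordinates, to apply additivity of variance over
    -- the product measure; injectivity of `g` ensures that each coordinate occurs at most once.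
    have := variance_sum_pi (μ := fun _ : ι => gaussianReal 0 1)
      (X := fun e x => if e ∈ Set.range g then x ^ 2 - 1 else 0)
      (fun e => by by_cases h : e ∈ Set.range g <;> simp only [h, if_true, if_false]
                   exacts [hm, MemLp.zero'])
    have e1 : (∑ e, fun x : ι → ℝ => if e ∈ Set.range g then x e ^ 2 - 1 else 0) =
        fun x => ∑ a, (x (g a) ^ 2 - 1) := by
      ext x
      rw [Finset.sum_apply, ← Finset.sum_filter]
      rw [← Finset.sum_image (s := Finset.univ) (g := g) (f := fun e => x e ^ 2 - 1) hg.injOn]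
      congr 1
      ext; simp
    rw [e1] at this
    rw [stdGaussianPi, this]
    have e2 (e : ι) : Var[fun x : ℝ => if e ∈ Set.range g then x ^ 2 - 1 else 0; gaussianReal 0 1] =
        if e ∈ Set.range g then Var[fun x : ℝ => x ^ 2 - 1; gaussianReal 0 1] else 0 := by
      by_cases h : e ∈ Set.range g <;> simp only [h, if_true, if_false]
      exact variance_zero _
    simp only [e2]
    rw [← Finset.sum_filter, Finset.sum_const, nsmul_eq_mul]
    congr 2
    rw [← Finset.card_univ, ← Finset.card_image_of_injective _ hg]
    congr 1
    ext; simp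
  rw [← hvar, variance_of_integral_eq_zero hsum.aestronglyMeasurable.aemeasurable hs0,
    ofReal_integral_eq_lintegral_ofReal hsum.integrable_sq (ae_of_all _ fun x => sq_nonneg _)]

lemma norm_ginibreOfReal_sq {N : ℕ} (z : (Fin N × Fin N → ℝ) × (Fin N × Fin N → ℝ)) (i j : Fin N) :
    ‖ginibreOfReal N z i j‖ ^ 2 = (2 * N : ℝ)⁻¹ * (z.1 (i, j) ^ 2 + z.2 (i, j) ^ 2) := by
  rw [ginibreOfReal, norm_mul, mul_pow, norm_inv, Complex.norm_real, Real.norm_eq_abs, inv_pow,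
    sq_abs, Real.sq_sqrt (by positivity), mul_comm Complex.I, Complex.sq_norm,
    Complex.normSq_add_mul_I]

lemma lintegral_norm_entry_sq {N : ℕ} (i j : Fin N) :
    ∫⁻ G, ENNReal.ofReal (‖G i j‖ ^ 2) ∂(ginibreLaw N) = ENNReal.ofReal (N : ℝ)⁻¹ := by
  have hN : (0 : ℝ) < N := by exact_mod_cast i.pos
  have hm := measurable_matrix_apply i j
  rw [ginibreLaw, lintegral_map (by fun_prop) (measurable_ginibreOfReal N)]
  simp only [norm_ginibreOfReal_sq]
  have h (z : (Fin N × Fin N → ℝ) × (Fin N × Fin N → ℝ)) :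
      ENNReal.ofReal ((2 * N : ℝ)⁻¹ * (z.1 (i, j) ^ 2 + z.2 (i, j) ^ 2)) =
      ENNReal.ofReal (2 * N : ℝ)⁻¹ * (ENNReal.ofReal (z.1 (i, j) ^ 2) +
        ENNReal.ofReal (z.2 (i, j) ^ 2)) := by
    rw [ENNReal.ofReal_mul (by positivity), ENNReal.ofReal_add (by positivity) (by positivity)]
  simp only [h]
  rw [lintegral_const_mul _ (by fun_prop), lintegral_add_left (by fun_prop),
    lintegral_prod _ (by fun_prop), lintegral_prod _ (by fun_prop)]
  simp only [lintegral_sq_stdGaussianPi, lintegral_const, measure_univ, mul_one]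
  rw [← ENNReal.ofReal_one, ← ENNReal.ofReal_add zero_le_one zero_le_one,
    ← ENNReal.ofReal_mul (by positivity)]
  congr 1
  field_simp
  norm_num

/-- The scalar `⟨x, G y⟩` has the law of `‖x‖ ‖y‖ G₀₀`. Both are placed in the `(0, 0)` entry of a
matrix so that `map_ginibreLaw_eq` applies; the adjoint of the first map is `T ↦ T₀₀ x y*`. -/
lemma lintegral_norm_dotProduct_mulVec_sq {N : ℕ} [NeZero N] (x y : Fin N → ℂ) :
    ∫⁻ G, ENNReal.ofReal (‖star x ⬝ᵥ (G *ᵥ y)‖ ^ 2) ∂(ginibreLaw N) =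
      ENNReal.ofReal (normSqSum x * normSqSum y / N) := by
  set c : ℝ := √(normSqSum x * normSqSum y) with hc
  have hc2 : c ^ 2 = normSqSum x * normSqSum y :=
    Real.sq_sqrt (mul_nonneg (normSqSum_nonneg _) (normSqSum_nonneg _))
  have m0 := measurable_matrix_apply (n := Fin N) 0 0
  have m₁ : Measurable fun G : Matrix (Fin N) (Fin N) ℂ =>
      Matrix.single (0 : Fin N) (0 : Fin N) (star x ⬝ᵥ (G *ᵥ y)) := by
    refine measurable_matrix_iff.2 fun i j => ?_
    simp only [Matrix.single_apply]
    split_ifs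
    · exact Measurable.star_dotProduct measurable_const (by fun_prop)
    · fun_prop
  have m₃ : Measurable fun G : Matrix (Fin N) (Fin N) ℂ =>
      Matrix.single (0 : Fin N) (0 : Fin N) ((c : ℂ) * G 0 0) := by
    refine measurable_matrix_iff.2 fun i j => ?_
    simp only [Matrix.single_apply]
    split_ifs <;> fun_prop
  have key := map_ginibreLaw_eq m₁ m₃
    (S₁' := fun T => T 0 0 • Matrix.vecMulVec x (star y))
    (S₃' := fun T => Matrix.single (0 : Fin N) (0 : Fin N) ((c : ℂ) * T 0 0))
    (fun T G => by
      rw [frobInner_eq_re_sum, frobInner_eq_re_sum]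
      congr 1
      rw [Finset.sum_eq_single 0 (fun a _ ha => by simp [ha.symm]) (by simp),
        Finset.sum_eq_single 0 (fun a _ ha => by simp [ha.symm]) (by simp)]
      simp only [Matrix.single_apply_same, dotProduct, Matrix.mulVec, Finset.mul_sum]
      refine Finset.sum_congr rfl fun a _ => Finset.sum_congr rfl fun b _ => ?_
      simp [Matrix.vecMulVec_apply]
      ring)
    (fun T G => by
      rw [frobInner_eq_re_sum, frobInner_eq_re_sum]
      congr 1
      refine Finset.sum_congr rfl fun a _ => Finset.sum_congr rfl fun b _ => ?_
      simp only [Matrix.single_apply]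
      split_ifs with h
      · rw [← h.1, ← h.2]
        simp
        ring
      · simp)
    (fun T => by
      rw [frobInner_self, frobInner_self]
      rw [Finset.sum_eq_single (a := (0 : Fin N)) (f := fun a => ∑ b, ‖Matrix.single (0 : Fin N)
        (0 : Fin N) ((c : ℂ) * T 0 0) a b‖ ^ 2)
        (fun a _ ha => by simp [ha.symm]) (by simp),
        Finset.sum_eq_single (a := (0 : Fin N)) (f := fun b => ‖Matrix.single (0 : Fin N)
        (0 : Fin N) ((c : ℂ) * T 0 0) 0 b‖ ^ 2)
        (fun a _ ha => by simp [ha.symm]) (by simp)]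
      simp only [Matrix.single_apply_same, Matrix.smul_apply, Matrix.vecMulVec_apply,
        Pi.star_apply, smul_eq_mul, norm_mul, norm_star, mul_pow, Complex.norm_real,
        Real.norm_eq_abs, sq_abs, hc2, normSqSum, Finset.sum_mul, Finset.mul_sum]
      rw [Finset.sum_comm]
      refine Finset.sum_congr rfl fun a _ => Finset.sum_congr rfl fun b _ => ?_
      ring)
  have l₁ := lintegral_map (μ := ginibreLaw N) (f := fun G : Matrix (Fin N) (Fin N) ℂ =>
    ENNReal.ofReal (‖G 0 0‖ ^ 2)) (by fun_prop) m₁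
  have l₃ := lintegral_map (μ := ginibreLaw N) (f := fun G : Matrix (Fin N) (Fin N) ℂ =>
    ENNReal.ofReal (‖G 0 0‖ ^ 2)) (by fun_prop) m₃
  rw [key, l₃] at l₁
  simp only [Matrix.single_apply_same] at l₁
  rw [← l₁]
  simp only [norm_mul, mul_pow, Complex.norm_real, Real.norm_eq_abs, sq_abs, hc2]
  have hnn := mul_nonneg (normSqSum_nonneg x) (normSqSum_nonneg y)
  simp only [ENNReal.ofReal_mul hnn]
  rw [lintegral_const_mul _ (by fun_prop), lintegral_norm_entry_sq, ← ENNReal.ofReal_mul hnn,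
    div_eq_mul_inv]

/-- The variance of the square of a standard Gaussian variable. -/
noncomputable def gaussianSqVariance : ℝ := Var[fun x : ℝ => x ^ 2 - 1; gaussianReal 0 1]

lemma gaussianSqVariance_nonneg : 0 ≤ gaussianSqVariance := variance_nonneg _ _

/-- The squared norm of a column is the mean of `2N` independent squared standard Gaussians.
Splitting real and imaginary parts by `(s + t)² ≤ 2 s² + 2 t²` loses a factor `2`, which is
harmless. -/
lemma lintegral_normSqSum_col_sub_one_sq_le {N : ℕ} (j : Fin N) :
    ∫⁻ G, ENNReal.ofReal ((normSqSum (fun a => G a j) - 1) ^ 2) ∂(ginibreLaw N) ≤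
      ENNReal.ofReal (gaussianSqVariance / N) := by
  have hN : (0 : ℝ) < N := by exact_mod_cast j.pos
  have hm : Measurable fun G : Matrix (Fin N) (Fin N) ℂ => fun a => G a j :=
    measurable_pi_iff.2 fun a => measurable_matrix_apply a j
  rw [ginibreLaw, lintegral_map (by fun_prop) (measurable_ginibreOfReal N)]
  have h (z : (Fin N × Fin N → ℝ) × (Fin N × Fin N → ℝ)) :
      ENNReal.ofReal ((normSqSum (fun a => ginibreOfReal N z a j) - 1) ^ 2) ≤
      ENNReal.ofReal (2 * (N : ℝ) ^ 2)⁻¹ * (ENNReal.ofReal ((∑ a, (z.1 (a, j) ^ 2 - 1)) ^ 2) +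
        ENNReal.ofReal ((∑ a, (z.2 (a, j) ^ 2 - 1)) ^ 2)) := by
    rw [← ENNReal.ofReal_add (by positivity) (by positivity), ← ENNReal.ofReal_mul (by positivity)]
    refine ENNReal.ofReal_le_ofReal ?_
    have e : normSqSum (fun a => ginibreOfReal N z a j) - 1 =
        (2 * N : ℝ)⁻¹ * ((∑ a, (z.1 (a, j) ^ 2 - 1)) + ∑ a, (z.2 (a, j) ^ 2 - 1)) := by
      simp only [normSqSum, norm_ginibreOfReal_sq, ← Finset.mul_sum, Finset.sum_add_distrib,
        Finset.sum_sub_distrib, Finset.sum_const, Finset.card_univ, Fintype.card_fin, nsmul_eq_mul]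
      field_simp
      ring
    rw [e, mul_pow]
    generalize (∑ a, (z.1 (a, j) ^ 2 - 1)) = s
    generalize (∑ a, (z.2 (a, j) ^ 2 - 1)) = t
    have e2 : (2 * (N : ℝ))⁻¹ ^ 2 = (2 * (N : ℝ) ^ 2)⁻¹ * 2⁻¹ := by ring
    rw [e2, mul_assoc]
    gcongr
    nlinarith [sq_nonneg (s - t)]
  refine (lintegral_mono h).trans ?_
  rw [lintegral_const_mul _ (by fun_prop), lintegral_add_left (by fun_prop),
    lintegral_prod _ (by fun_prop), lintegral_prod _ (by fun_prop)]
  simp only [lintegral_const, measure_univ, mul_one]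
  have hj : Function.Injective fun a : Fin N => (a, j) := fun a b h => (Prod.mk.inj h).1
  rw [lintegral_sum_sq_sub_one_sq _ hj]
  have := gaussianSqVariance_nonneg
  change ENNReal.ofReal _ * (ENNReal.ofReal (_ * gaussianSqVariance) +
    ENNReal.ofReal (_ * gaussianSqVariance)) ≤ _
  rw [← ENNReal.ofReal_add (by positivity) (by positivity), ← ENNReal.ofReal_mul (by positivity)]
  refine ENNReal.ofReal_le_ofReal (le_of_eq ?_)
  rw [Fintype.card_fin]
  field_simp
  ring

/-- `G y` has the law of `‖y‖` times the first column of `G`, so the column estimate applies. Both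
vectors are placed in column `0` of a matrix to compare their laws. -/
lemma lintegral_normSqSum_mulVec_sub_sq_le {N : ℕ} [NeZero N] (y : Fin N → ℂ) :
    ∫⁻ G, ENNReal.ofReal ((normSqSum (G *ᵥ y) - normSqSum y) ^ 2) ∂(ginibreLaw N) ≤
      ENNReal.ofReal (gaussianSqVariance / N * normSqSum y ^ 2) := by
  set c : ℝ := √(normSqSum y) with hc
  have hc2 : c ^ 2 = normSqSum y := Real.sq_sqrt (normSqSum_nonneg _)
  have hcol : Measurable fun G : Matrix (Fin N) (Fin N) ℂ => fun a => G a 0 :=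
    measurable_pi_iff.2 fun a => measurable_matrix_apply a 0
  have m₁ : Measurable fun G : Matrix (Fin N) (Fin N) ℂ =>
      (Matrix.of fun a b => if b = 0 then (G *ᵥ y) a else 0 : Matrix (Fin N) (Fin N) ℂ) := by
    refine measurable_matrix_iff.2 fun i j => ?_
    simp only [Matrix.of_apply]
    split_ifs
    · exact (measurable_pi_apply i).comp (Measurable.matrix_mulVec measurable_id measurable_const)
    · fun_prop
  have m₃ : Measurable fun G : Matrix (Fin N) (Fin N) ℂ =>
      (Matrix.of fun a b => if b = 0 then (c : ℂ) * G a 0 else 0 : Matrix (Fin N) (Fin N) ℂ) := by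
    refine measurable_matrix_iff.2 fun i j => ?_
    simp only [Matrix.of_apply]
    split_ifs
    · exact (measurable_matrix_apply i 0).const_mul _
    · fun_prop
  have key := map_ginibreLaw_eq m₁ m₃
    (S₁' := fun T => Matrix.of fun a b => T a 0 * star (y b))
    (S₃' := fun T => Matrix.of fun a b => if b = 0 then (c : ℂ) * T a 0 else 0)
    (fun T G => by
      rw [frobInner_eq_re_sum, frobInner_eq_re_sum]
      congr 1
      refine Finset.sum_congr rfl fun a _ => ?_
      simp only [Matrix.of_apply, mul_ite, mul_zero, Finset.sum_ite_eq', Finset.mem_univ, if_true,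
        Matrix.mulVec, dotProduct, Finset.mul_sum]
      refine Finset.sum_congr rfl fun b _ => ?_
      simp
      ring)
    (fun T G => by
      rw [frobInner_eq_re_sum, frobInner_eq_re_sum]
      congr 1
      refine Finset.sum_congr rfl fun a _ => Finset.sum_congr rfl fun b _ => ?_
      simp only [Matrix.of_apply]
      split_ifs with h
      · rw [h]
        simp
        ring
      · simp)
    (fun T => by
      rw [frobInner_self, frobInner_self]
      refine Finset.sum_congr rfl fun a _ => ?_
      rw [Finset.sum_eq_single (a := (0 : Fin N)) (f := fun b => ‖(Matrix.of fun a b =>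
        if b = 0 then (c : ℂ) * T a 0 else 0 : Matrix (Fin N) (Fin N) ℂ) a b‖ ^ 2)
        (fun b _ hb => by simp [hb]) (by simp)]
      simp only [Matrix.of_apply, if_true, norm_mul, norm_star, mul_pow, Complex.norm_real,
        Real.norm_eq_abs, sq_abs, hc2, normSqSum, Finset.sum_mul]
      refine Finset.sum_congr rfl fun b _ => ?_
      ring)
  have hf : Measurable fun G : Matrix (Fin N) (Fin N) ℂ =>
      ENNReal.ofReal ((normSqSum (fun a => G a 0) - normSqSum y) ^ 2) := by fun_prop
  have l₁ := lintegral_map (μ := ginibreLaw N) hf m₁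
  have l₃ := lintegral_map (μ := ginibreLaw N) hf m₃
  rw [key, l₃] at l₁
  simp only [Matrix.of_apply, if_true] at l₁
  rw [show (∫⁻ G, ENNReal.ofReal ((normSqSum (G *ᵥ y) - normSqSum y) ^ 2) ∂(ginibreLaw N)) =
    _ from l₁.symm]
  have e (G : Matrix (Fin N) (Fin N) ℂ) :
      ENNReal.ofReal ((normSqSum (fun a => (c : ℂ) * G a 0) - normSqSum y) ^ 2) =
      ENNReal.ofReal (normSqSum y ^ 2) *
        ENNReal.ofReal ((normSqSum (fun a => G a 0) - 1) ^ 2) := by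
    rw [← ENNReal.ofReal_mul (by positivity), ← mul_pow]
    congr 2
    simp only [normSqSum, norm_mul, mul_pow, Complex.norm_real, Real.norm_eq_abs, sq_abs,
      ← Finset.mul_sum]
    rw [hc2, normSqSum]
    ring
  simp only [e]
  rw [lintegral_const_mul _ (by fun_prop), mul_comm (gaussianSqVariance / N),
    ENNReal.ofReal_mul (by positivity)]
  gcongr
  exact lintegral_normSqSum_col_sub_one_sq_le 0

lemma lintegral_normSqSum_mulVec_sq_le {N : ℕ} [NeZero N] (y : Fin N → ℂ) :
    ∫⁻ G, ENNReal.ofReal (normSqSum (G *ᵥ y) ^ 2) ∂(ginibreLaw N) ≤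
      ENNReal.ofReal (2 * gaussianSqVariance + 2) * ENNReal.ofReal (normSqSum y ^ 2) := by
  have hN : (1 : ℝ) ≤ N := by exact_mod_cast NeZero.one_le
  have hv := gaussianSqVariance_nonneg
  have h (G : Matrix (Fin N) (Fin N) ℂ) : ENNReal.ofReal (normSqSum (G *ᵥ y) ^ 2) ≤
      ENNReal.ofReal 2 * ENNReal.ofReal ((normSqSum (G *ᵥ y) - normSqSum y) ^ 2) +
      ENNReal.ofReal (2 * normSqSum y ^ 2) := by
    rw [← ENNReal.ofReal_mul (by positivity), ← ENNReal.ofReal_add (by positivity) (by positivity)]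
    refine ENNReal.ofReal_le_ofReal ?_
    nlinarith [sq_nonneg (normSqSum (G *ᵥ y) - 2 * normSqSum y)]
  refine (lintegral_mono h).trans ?_
  rw [lintegral_add_right _ measurable_const, lintegral_const_mul _ (by fun_prop), lintegral_const,
    measure_univ, mul_one]
  refine (add_le_add_left (mul_le_mul_right (lintegral_normSqSum_mulVec_sub_sq_le y) _) _).trans ?_
  rw [← ENNReal.ofReal_mul (by positivity), ← ENNReal.ofReal_mul (by positivity),
    ← ENNReal.ofReal_add (by positivity) (by positivity)]
  refine ENNReal.ofReal_le_ofReal ?_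
  have : gaussianSqVariance / N ≤ gaussianSqVariance := div_le_self hv hN
  nlinarith [mul_le_mul_of_nonneg_right this (sq_nonneg (normSqSum y))]

end Moments

/-! ### Decoupling the Arnoldi process from the unexplored part of the matrix -/

section Decoupling

@[fun_prop]
lemma Measurable.lineProj {α n : Type*} [MeasurableSpace α] [Fintype n]
    {v : α → n → ℂ} (hv : Measurable v) : Measurable fun x => lineProj (v x) := by
  refine measurable_matrix_iff.2 fun i j => ?_
  have h (i : n) : Measurable fun x => v x i := (measurable_pi_apply i).comp hv
  simp only [_root_.lineProj, Matrix.smul_apply, Matrix.vecMulVec_apply, smul_eq_mul, Pi.star_apply,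
    RCLike.star_def]
  exact (hv.star_dotProduct hv).inv.mul
    ((h i).mul (Complex.continuous_conj.measurable.comp (h j)))

lemma measurable_arnoldi {n : Type*} [Fintype n] [DecidableEq n] (j : ℕ) :
    Measurable fun z : (n → ℂ) × Matrix n n ℂ => arnoldi z.2 z.1 j := by
  induction j with
  | zero => exact measurable_fst.prodMk measurable_const
  | succ j ih =>
    simp only [arnoldi]
    fun_prop

@[fun_prop]
lemma Measurable.arnoldiVec {α n : Type*} [MeasurableSpace α] [Fintype n] [DecidableEq n]
    {G : α → Matrix n n ℂ} {u : α → n → ℂ} (hG : Measurable G) (hu : Measurable u) (j : ℕ) :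
    Measurable fun x => arnoldiVec (G x) (u x) j :=
  measurable_fst.comp ((measurable_arnoldi j).comp (hu.prodMk hG))

@[fun_prop]
lemma Measurable.arnoldiProj {α n : Type*} [MeasurableSpace α] [Fintype n] [DecidableEq n]
    {G : α → Matrix n n ℂ} {u : α → n → ℂ} (hG : Measurable G) (hu : Measurable u) (j : ℕ) :
    Measurable fun x => arnoldiProj (G x) (u x) j :=
  measurable_snd.comp ((measurable_arnoldi j).comp (hu.prodMk hG))

/-- Replace the action of `G` on the orthogonal complement of the span of the first `j` Arnoldi
vectors by the action of `G'`. -/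
noncomputable def arnoldiResample {n : Type*} [Fintype n] [DecidableEq n] (u : n → ℂ) (j : ℕ)
    (G G' : Matrix n n ℂ) : Matrix n n ℂ :=
  G * arnoldiProj G u j + G' * (1 - arnoldiProj G u j)

lemma arnoldi_arnoldiResample {n : Type*} [Fintype n] [DecidableEq n] (u : n → ℂ) {i j : ℕ}
    (G G' : Matrix n n ℂ) (h : i ≤ j) :
    arnoldi (arnoldiResample u j G G') u i = arnoldi G u i := by
  refine arnoldi_congr ?_ h
  rw [arnoldiResample, add_mul, mul_assoc, mul_assoc, sub_mul, arnoldiProj_mul_self]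
  simp

lemma arnoldiVec_arnoldiResample {n : Type*} [Fintype n] [DecidableEq n] (u : n → ℂ) {i j : ℕ}
    (G G' : Matrix n n ℂ) (h : i ≤ j) :
    arnoldiVec (arnoldiResample u j G G') u i = arnoldiVec G u i := by
  rw [arnoldiVec, arnoldi_arnoldiResample u G G' h, arnoldiVec]

/-- The index `j + 1` is right: this projection involves only `v_0, …, v_j`, and producing `v_j`
uses `G` only on `v_0, …, v_{j-1}`. -/
lemma arnoldiProj_arnoldiResample {n : Type*} [Fintype n] [DecidableEq n] (u : n → ℂ) {j : ℕ}
    (G G' : Matrix n n ℂ) :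
    arnoldiProj (arnoldiResample u j G G') u (j + 1) = arnoldiProj G u (j + 1) := by
  rw [arnoldiProj_succ, arnoldiProj_succ, arnoldiVec_arnoldiResample u G G' le_rfl, arnoldiProj,
    arnoldi_arnoldiResample u G G' le_rfl, arnoldiProj]

lemma arnoldiResample_mulVec {n : Type*} [Fintype n] [DecidableEq n] (u : n → ℂ) (j : ℕ)
    (G G' : Matrix n n ℂ) :
    arnoldiResample u j G G' *ᵥ arnoldiVec G u j = G' *ᵥ arnoldiVec G u j := by
  rw [arnoldiResample, Matrix.add_mulVec, ← Matrix.mulVec_mulVec, ← Matrix.mulVec_mulVec,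
    Matrix.sub_mulVec, arnoldiProj_mulVec_arnoldiVec]
  simp

lemma measurable_arnoldiResample {n : Type*} [Fintype n] [DecidableEq n] (u : n → ℂ) (j : ℕ) :
    Measurable fun z : Matrix n n ℂ × Matrix n n ℂ => arnoldiResample u j z.1 z.2 := by
  unfold arnoldiResample
  fun_prop

/-- Conditionally on the first `j` steps of the Arnoldi process, the action of a Ginibre matrix on
the orthogonal complement of the Arnoldi vectors is that of an independent Ginibre matrix. -/
lemma lintegral_arnoldiResample {N : ℕ} (u : Fin N → ℂ) (j : ℕ)
    {f : Matrix (Fin N) (Fin N) ℂ → ENNReal} (hf : Measurable f) :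
    ∫⁻ G, ∫⁻ G', f (arnoldiResample u j G G') ∂(ginibreLaw N) ∂(ginibreLaw N) =
      ∫⁻ G, f G ∂(ginibreLaw N) := by
  induction j generalizing f with
  | zero => simp [arnoldiResample]
  | succ j ih =>
    have hr := measurable_arnoldiResample (n := Fin N) u (j + 1)
    have hF : Measurable fun G => ∫⁻ G', f (arnoldiResample u (j + 1) G G') ∂(ginibreLaw N) :=
      (hf.comp hr).lintegral_prod_right'
    -- Both sides are resampled at level `j`. With `G` fixed, the projections of levels `j` and `j +
    -- 1` are deterministic, so the fresh matrix on the complement of level `j` can be split into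
    -- independent ones on the new line and on the complement of level `j + 1`.
    rw [← ih hF, ← ih hf]
    refine lintegral_congr fun G => ?_
    have hA : (arnoldiProj G u (j + 1) - arnoldiProj G u j).IsHermitian :=
      (arnoldiProj_isHermitian G u _).sub (arnoldiProj_isHermitian G u _)
    have hB : (1 - arnoldiProj G u (j + 1)).IsHermitian :=
      Matrix.isHermitian_one.sub (arnoldiProj_isHermitian G u _)
    have hcomm : arnoldiProj G u j * arnoldiProj G u (j + 1) = arnoldiProj G u j := by
      simpa [Matrix.conjTranspose_mul, (arnoldiProj_isHermitian G u _).eq] using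
        congrArg Matrix.conjTranspose (arnoldiProj_succ_mul G u j)
    have hAB : (arnoldiProj G u (j + 1) - arnoldiProj G u j) *
        (1 - arnoldiProj G u (j + 1)) = 0 := by
      rw [mul_sub, mul_one, sub_mul, hcomm, arnoldiProj_mul_self, sub_self]
    have key := lintegral_ginibreLaw_mul_add_mul hA hB hAB
      (f := fun M => f (G * arnoldiProj G u j + M)) (by fun_prop)
    rw [show arnoldiProj G u (j + 1) - arnoldiProj G u j + (1 - arnoldiProj G u (j + 1)) =
      1 - arnoldiProj G u j by abel] at key
    rw [show (∫⁻ G', f (arnoldiResample u j G G') ∂(ginibreLaw N)) = _ from key.symm]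
    refine lintegral_congr fun G₁ => lintegral_congr fun G₂ => ?_
    congr 1
    rw [arnoldiResample, arnoldiProj_arnoldiResample, arnoldiResample, add_mul, mul_assoc,
      mul_assoc, hcomm, sub_mul, hcomm, one_mul, add_assoc]

/-- After resampling at level `j`, the vector `v_j` depends on `G` alone while the matrix acting on
it is the independent `G'`, so the estimate for a fixed vector applies to the inner integral. The
later moment bounds follow the same pattern. -/
lemma lintegral_normSqSum_mulVec_arnoldiVec_sq_le {N : ℕ} [NeZero N] (u : Fin N → ℂ) (j : ℕ) :
    ∫⁻ G, ENNReal.ofReal (normSqSum (G *ᵥ arnoldiVec G u j) ^ 2) ∂(ginibreLaw N) ≤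
      ENNReal.ofReal (2 * gaussianSqVariance + 2) *
        ∫⁻ G, ENNReal.ofReal (normSqSum (arnoldiVec G u j) ^ 2) ∂(ginibreLaw N) := by
  rw [← lintegral_arnoldiResample u j (by fun_prop), ← lintegral_const_mul _ (by fun_prop)]
  refine lintegral_mono fun G => ?_
  simp only [arnoldiVec_arnoldiResample u G _ le_rfl, arnoldiResample_mulVec]
  exact lintegral_normSqSum_mulVec_sq_le _

/-- A bound for the fourth moment of the norm of the `j`-th Arnoldi vector. -/
noncomputable def arnoldiMomentBound (j : ℕ) : ℝ := (2 * gaussianSqVariance + 2) ^ j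

lemma arnoldiMomentBound_nonneg (j : ℕ) : 0 ≤ arnoldiMomentBound j :=
  pow_nonneg (by linarith [gaussianSqVariance_nonneg]) _

lemma lintegral_normSqSum_arnoldiVec_sq_le {N : ℕ} [NeZero N] {u : Fin N → ℂ}
    (hu : normSqSum u ≤ 1) (j : ℕ) :
    ∫⁻ G, ENNReal.ofReal (normSqSum (arnoldiVec G u j) ^ 2) ∂(ginibreLaw N) ≤
      ENNReal.ofReal (arnoldiMomentBound j) := by
  induction j with
  | zero =>
    simp only [arnoldiVec_zero, lintegral_const, measure_univ, mul_one, arnoldiMomentBound,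
      pow_zero]
    exact ENNReal.ofReal_le_ofReal (pow_le_one₀ (normSqSum_nonneg _) hu)
  | succ j ih =>
    have h : 0 ≤ 2 * gaussianSqVariance + 2 := by linarith [gaussianSqVariance_nonneg]
    rw [arnoldiMomentBound, pow_succ', ENNReal.ofReal_mul h]
    refine le_trans ?_ (mul_le_mul_right ih _)
    refine le_trans (lintegral_mono fun G => ENNReal.ofReal_le_ofReal ?_)
      (lintegral_normSqSum_mulVec_arnoldiVec_sq_le u j)
    exact pow_le_pow_left₀ (normSqSum_nonneg _) (normSqSum_arnoldiVec_succ_le G u j) 2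

lemma lintegral_normSqSum_mulVec_arnoldiVec_sub_sq_le {N : ℕ} [NeZero N] {u : Fin N → ℂ}
    (hu : normSqSum u ≤ 1) (j : ℕ) :
    ∫⁻ G, ENNReal.ofReal ((normSqSum (G *ᵥ arnoldiVec G u j) - normSqSum (arnoldiVec G u j)) ^ 2)
      ∂(ginibreLaw N) ≤ ENNReal.ofReal (gaussianSqVariance * arnoldiMomentBound j / N) := by
  have hv := gaussianSqVariance_nonneg
  rw [← lintegral_arnoldiResample u j (by fun_prop)]
  refine (lintegral_mono (g := fun G => ENNReal.ofReal (gaussianSqVariance / N) *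
    ENNReal.ofReal (normSqSum (arnoldiVec G u j) ^ 2)) fun G => ?_).trans ?_
  · simp only [arnoldiVec_arnoldiResample u G _ le_rfl, arnoldiResample_mulVec]
    rw [← ENNReal.ofReal_mul (by positivity)]
    exact lintegral_normSqSum_mulVec_sub_sq_le _
  · rw [lintegral_const_mul _ (by fun_prop), mul_div_right_comm, ENNReal.ofReal_mul (by positivity)]
    gcongr
    exact lintegral_normSqSum_arnoldiVec_sq_le hu j

lemma lintegral_norm_dotProduct_mulVec_arnoldiVec_sq_le {N : ℕ} [NeZero N] {u : Fin N → ℂ}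
    (hu : normSqSum u ≤ 1) {i j : ℕ} (hij : i ≤ j) :
    ∫⁻ G, ENNReal.ofReal (‖star (arnoldiVec G u i) ⬝ᵥ (G *ᵥ arnoldiVec G u j)‖ ^ 2)
      ∂(ginibreLaw N) ≤
      ENNReal.ofReal ((arnoldiMomentBound i + arnoldiMomentBound j) / N) := by
  have hi := arnoldiMomentBound_nonneg i
  have hj := arnoldiMomentBound_nonneg j
  rw [← lintegral_arnoldiResample u j (by fun_prop)]
  refine (lintegral_mono (g := fun G => ENNReal.ofReal (N : ℝ)⁻¹ *
    (ENNReal.ofReal (normSqSum (arnoldiVec G u i) ^ 2) +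
      ENNReal.ofReal (normSqSum (arnoldiVec G u j) ^ 2))) fun G => ?_).trans ?_
  · simp only [arnoldiVec_arnoldiResample u G _ le_rfl, arnoldiVec_arnoldiResample u G _ hij,
      arnoldiResample_mulVec]
    rw [lintegral_norm_dotProduct_mulVec_sq, ← ENNReal.ofReal_add (by positivity) (by positivity),
      ← ENNReal.ofReal_mul (by positivity), div_eq_inv_mul]
    gcongr
    -- `‖v_i‖² ‖v_j‖² ≤ ‖v_i‖⁴ + ‖v_j‖⁴`, which avoids joint moments.
    nlinarith [sq_nonneg (normSqSum (arnoldiVec G u i) - normSqSum (arnoldiVec G u j)),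
      sq_nonneg (normSqSum (arnoldiVec G u i)), sq_nonneg (normSqSum (arnoldiVec G u j))]
  · rw [lintegral_const_mul _ (by fun_prop), lintegral_add_left (by fun_prop), div_eq_inv_mul,
      ENNReal.ofReal_mul (by positivity), ENNReal.ofReal_add hi hj]
    gcongr
    · exact lintegral_normSqSum_arnoldiVec_sq_le hu i
    · exact lintegral_normSqSum_arnoldiVec_sq_le hu j

end Decoupling

/-! ### Convergence in probability to constants -/

section ConvergenceInProbability

variable {Ω : Type*} [MeasurableSpace Ω] {P : Measure Ω}

lemma MeasureTheory.TendstoInMeasure.continuousAt_comp {E F : Type*} [PseudoMetricSpace E]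
    [PseudoMetricSpace F] {X : ℕ → Ω → E} {c : E} {f : E → F}
    (h : TendstoInMeasure P X atTop fun _ => c) (hf : ContinuousAt f c) :
    TendstoInMeasure P (fun N ω => f (X N ω)) atTop fun _ => f c := by
  rw [tendstoInMeasure_iff_dist] at h ⊢
  intro ε hε
  obtain ⟨δ, hδ, hfδ⟩ := Metric.continuousAt_iff.1 hf ε hε
  refine tendsto_of_tendsto_of_tendsto_of_le_of_le tendsto_const_nhds (h δ hδ)
    (fun _ => zero_le) fun N => measure_mono fun ω hω => ?_
  by_contra hlt
  exact (hfδ (not_le.1 hlt)).not_ge hω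

lemma MeasureTheory.TendstoInMeasure.prodMk_const {E F : Type*} [PseudoMetricSpace E]
    [PseudoMetricSpace F] {X : ℕ → Ω → E} {Y : ℕ → Ω → F} {c : E} {d : F}
    (hX : TendstoInMeasure P X atTop fun _ => c) (hY : TendstoInMeasure P Y atTop fun _ => d) :
    TendstoInMeasure P (fun N ω => (X N ω, Y N ω)) atTop fun _ => (c, d) := by
  rw [tendstoInMeasure_iff_dist] at hX hY ⊢
  intro ε hε
  have h := (hX ε hε).add (hY ε hε)
  rw [add_zero] at h
  refine tendsto_of_tendsto_of_tendsto_of_le_of_le tendsto_const_nhds h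
    (fun _ => zero_le) fun N => (measure_mono fun ω hω => ?_).trans (measure_union_le _ _)
  simpa [Prod.dist_eq] using hω

lemma tendstoInMeasure_const {E : Type*} [PseudoMetricSpace E] (c : E) :
    TendstoInMeasure P (fun (_ : ℕ) (_ : Ω) => c) atTop fun _ => c := by
  rw [tendstoInMeasure_iff_dist]
  intro ε hε
  simp [hε.not_ge]

lemma MeasureTheory.TendstoInMeasure.add_const_limit {X Y : ℕ → Ω → ℂ} {c d : ℂ}
    (hX : TendstoInMeasure P X atTop fun _ => c) (hY : TendstoInMeasure P Y atTop fun _ => d) :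
    TendstoInMeasure P (fun N ω => X N ω + Y N ω) atTop fun _ => c + d := by
  have hf : ContinuousAt (fun z : ℂ × ℂ => z.1 + z.2) (c, d) := by fun_prop
  have h := (hX.prodMk_const hY).continuousAt_comp hf
  exact h

lemma MeasureTheory.TendstoInMeasure.sub_const_limit {X Y : ℕ → Ω → ℂ} {c d : ℂ}
    (hX : TendstoInMeasure P X atTop fun _ => c) (hY : TendstoInMeasure P Y atTop fun _ => d) :
    TendstoInMeasure P (fun N ω => X N ω - Y N ω) atTop fun _ => c - d := by
  have hf : ContinuousAt (fun z : ℂ × ℂ => z.1 - z.2) (c, d) := by fun_prop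
  have h := (hX.prodMk_const hY).continuousAt_comp hf
  exact h

lemma MeasureTheory.TendstoInMeasure.mul_const_limit {X Y : ℕ → Ω → ℂ} {c d : ℂ}
    (hX : TendstoInMeasure P X atTop fun _ => c) (hY : TendstoInMeasure P Y atTop fun _ => d) :
    TendstoInMeasure P (fun N ω => X N ω * Y N ω) atTop fun _ => c * d := by
  have hf : ContinuousAt (fun z : ℂ × ℂ => z.1 * z.2) (c, d) := by fun_prop
  have h := (hX.prodMk_const hY).continuousAt_comp hf
  exact h

lemma MeasureTheory.TendstoInMeasure.star_const_limit {X : ℕ → Ω → ℂ} {c : ℂ}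
    (hX : TendstoInMeasure P X atTop fun _ => c) :
    TendstoInMeasure P (fun N ω => star (X N ω)) atTop fun _ => star c :=
  hX.continuousAt_comp (f := star) (by fun_prop)

lemma tendstoInMeasure_sum {ι : Type*} (s : Finset ι) {X : ι → ℕ → Ω → ℂ} {c : ι → ℂ}
    (h : ∀ i ∈ s, TendstoInMeasure P (X i) atTop fun _ => c i) :
    TendstoInMeasure P (fun N ω => ∑ i ∈ s, X i N ω) atTop fun _ => ∑ i ∈ s, c i := by
  classical
  induction s using Finset.induction_on with
  | empty => simpa using tendstoInMeasure_const (0 : ℂ)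
  | insert a s ha ih =>
    simp only [Finset.sum_insert ha]
    exact (h a (by simp)).add_const_limit (ih fun i hi => h i (by simp [hi]))

/-- Chebyshev's inequality. The bound is required only for `1 ≤ N`, since `C / 0 = 0` would be a
false demand on the initial term. -/
lemma tendstoInMeasure_zero_of_lintegral_sq_le {X : ℕ → Ω → ℂ} {C : ℝ}
    (hm : ∀ N, AEMeasurable (X N) P)
    (h : ∀ N, 1 ≤ N → ∫⁻ ω, ENNReal.ofReal (‖X N ω‖ ^ 2) ∂P ≤ ENNReal.ofReal (C / N)) :
    TendstoInMeasure P X atTop fun _ => 0 := by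
  rw [tendstoInMeasure_iff_dist]
  intro ε hε
  have hlim : Tendsto (fun N : ℕ => ENNReal.ofReal (C / N) / ENNReal.ofReal (ε ^ 2)) atTop
      (nhds 0) := by
    have h1 := ENNReal.tendsto_ofReal (tendsto_const_div_atTop_nhds_zero_nat C)
    have := ENNReal.Tendsto.div_const h1 (b := ENNReal.ofReal (ε ^ 2))
      (Or.inr (by simpa using hε.ne'))
    simpa using this
  refine tendsto_of_tendsto_of_tendsto_of_le_of_le' tendsto_const_nhds hlim
    (Eventually.of_forall fun _ => zero_le) ?_
  filter_upwards [eventually_ge_atTop 1] with N hN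
  have hmN := hm N
  have := meas_ge_le_lintegral_div (μ := P) (f := fun ω => ENNReal.ofReal (‖X N ω‖ ^ 2))
    (by fun_prop) (ε := ENNReal.ofReal (ε ^ 2)) (by simpa using hε.ne') (by simp)
  refine (measure_mono fun ω hω => ?_).trans (this.trans (ENNReal.div_le_div_right (h N hN) _))
  refine ENNReal.ofReal_le_ofReal (pow_le_pow_left₀ hε.le ?_ 2)
  simpa using hω

end ConvergenceInProbability

/-! ### Krylov vectors in the Arnoldi basis -/

section KrylovGram

variable {n : Type*} [Fintype n] [DecidableEq n]

/-- The coefficient of the `i`-th Arnoldi vector in the `m`-th Krylov vector `G ^ m u`. -/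
noncomputable def krylovCoeff (G : Matrix n n ℂ) (u : n → ℂ) : ℕ → ℕ → ℂ
  | 0, i => if i = 0 then 1 else 0
  | m + 1, i => (if i = 0 then 0 else krylovCoeff G u m (i - 1)) +
      ∑ l ∈ Finset.range (m + 1), if i ≤ l then arnoldiCoeff G u i l * krylovCoeff G u m l else 0

/-- By `mulVec_arnoldiVec`, applying `G` shifts the coefficients by one, with subdiagonal entry `1`
as nothing is normalised, and adds the Hessenberg terms. -/
lemma pow_mulVec_eq_sum (G : Matrix n n ℂ) (u : n → ℂ) (m : ℕ) :
    G ^ m *ᵥ u = ∑ i ∈ Finset.range (m + 1), krylovCoeff G u m i • arnoldiVec G u i := by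
  induction m with
  | zero => simp [krylovCoeff]
  | succ m ih =>
    rw [pow_succ', ← Matrix.mulVec_mulVec, ih, Matrix.mulVec_sum]
    simp only [krylovCoeff, add_smul, Finset.sum_add_distrib, Matrix.mulVec_smul,
      mulVec_arnoldiVec, smul_add]
    congr 1
    · rw [Finset.sum_range_succ' _ (m + 1)]
      simp
    · simp only [Finset.sum_smul]
      rw [Finset.sum_comm]
      refine Finset.sum_congr rfl fun l hl => ?_
      rw [Finset.smul_sum]
      simp only [ite_smul, zero_smul]
      rw [← Finset.sum_filter]
      have : Finset.filter (fun i => i ≤ l) (Finset.range (m + 1 + 1)) = Finset.range (l + 1) := by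
        ext i
        simp only [Finset.mem_filter, Finset.mem_range] at hl ⊢
        omega
      rw [this]
      refine Finset.sum_congr rfl fun i _ => ?_
      rw [smul_smul, mul_comm]

lemma star_pow_mulVec_dotProduct (G : Matrix n n ℂ) (u : n → ℂ) (i j : ℕ) :
    star (G ^ i *ᵥ u) ⬝ᵥ (G ^ j *ᵥ u) =
      ∑ a ∈ Finset.range (i + 1), ∑ b ∈ Finset.range (j + 1),
        star (krylovCoeff G u i a) * krylovCoeff G u j b *
          (star (arnoldiVec G u a) ⬝ᵥ arnoldiVec G u b) := by
  rw [pow_mulVec_eq_sum, pow_mulVec_eq_sum, star_sum, sum_dotProduct]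
  refine Finset.sum_congr rfl fun a _ => ?_
  rw [dotProduct_sum]
  refine Finset.sum_congr rfl fun b _ => ?_
  rw [star_smul, smul_dotProduct, dotProduct_smul, smul_eq_mul, smul_eq_mul, mul_assoc]

end KrylovGram

/-! ### Asymptotic orthonormality of the Krylov vectors -/

section GinibreKrylov

variable {Ω : Type*} [MeasurableSpace Ω] {P : Measure Ω} [IsProbabilityMeasure P]

lemma IsGinibre.aemeasurable_and_map_eq {N : ℕ} {G : Ω → Matrix (Fin N) (Fin N) ℂ}
    (h : IsGinibre P G) : AEMeasurable G P ∧ P.map G = ginibreLaw N := by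
  obtain ⟨X, Y, hX, hY, iX, iY, hXY, hG⟩ := h
  let X' : Ω → Fin N × Fin N → ℝ := fun ω e => X ω e.1 e.2
  let Y' : Ω → Fin N × Fin N → ℝ := fun ω e => Y ω e.1 e.2
  have mX : AEMeasurable X' P := aemeasurable_pi_lambda _ fun e => (hX e.1 e.2).aemeasurable
  have mY : AEMeasurable Y' P := aemeasurable_pi_lambda _ fun e => (hY e.1 e.2).aemeasurable
  have lX : P.map X' = stdGaussianPi (Fin N × Fin N) := by
    have h := iX.map_fun_eq_pi_map fun e : Fin N × Fin N => (hX e.1 e.2).aemeasurable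
    simp only [(hX _ _).map_eq] at h
    exact h
  have lY : P.map Y' = stdGaussianPi (Fin N × Fin N) := by
    have h := iY.map_fun_eq_pi_map fun e : Fin N × Fin N => (hY e.1 e.2).aemeasurable
    simp only [(hY _ _).map_eq] at h
    exact h
  have hunc : Measurable fun (x : Fin N → Fin N → ℝ) (e : Fin N × Fin N) => x e.1 e.2 := by
    fun_prop
  have hind : IndepFun X' Y' P := hXY.comp hunc hunc
  have hGe : G = fun ω => ginibreOfReal N (X' ω, Y' ω) := by
    ext ω i j
    exact hG ω i j
  have hm := measurable_ginibreOfReal N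
  refine ⟨hGe ▸ hm.comp_aemeasurable (mX.prodMk mY), ?_⟩
  have hjoint := hind.map_prod_eq_prod_map_map mX mY
  rw [lX, lY] at hjoint
  rw [hGe, ginibreLaw, ← hjoint]
  exact (AEMeasurable.map_map_of_aemeasurable hm.aemeasurable (mX.prodMk mY)).symm

/-- By independence the joint law is a product, so a bound uniform over deterministic starting
vectors passes to a random one. -/
lemma lintegral_le_of_indepFun_ginibre {N : ℕ} {G : Ω → Matrix (Fin N) (Fin N) ℂ}
    (hG : IsGinibre P G) {U : Ω → Fin N → ℂ} (hU : AEMeasurable U P)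
    (hU1 : ∀ ω, normSqSum (U ω) ≤ 1)
    (hind : IndepFun U G P) {F : (Fin N → ℂ) × Matrix (Fin N) (Fin N) ℂ → ENNReal}
    (hF : Measurable F) {C : ENNReal}
    (h : ∀ u, normSqSum u ≤ 1 → ∫⁻ g, F (u, g) ∂(ginibreLaw N) ≤ C) :
    ∫⁻ ω, F (U ω, G ω) ∂P ≤ C := by
  obtain ⟨mG, lG⟩ := hG.aemeasurable_and_map_eq
  rw [← lintegral_map' (f := F) hF.aemeasurable (hU.prodMk mG),
    hind.map_prod_eq_prod_map_map hU mG, lG, lintegral_prod _ hF.aemeasurable,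
    lintegral_map' hF.lintegral_prod_right'.aemeasurable hU]
  refine (lintegral_mono fun ω => h (U ω) (hU1 ω)).trans ?_
  simp

variable {G : (N : ℕ) → Ω → Matrix (Fin N) (Fin N) ℂ} {U : (N : ℕ) → Ω → Fin N → ℂ}

lemma tendstoInMeasure_dotProduct_mulVec_arnoldiVec (hG : ∀ N, IsGinibre P (G N))
    (hU : ∀ N, AEMeasurable (U N) P) (hU1 : ∀ N ω, normSqSum (U N ω) ≤ 1)
    (hind : ∀ N, IndepFun (U N) (G N) P) {i j : ℕ} (hij : i ≤ j) :
    TendstoInMeasure P (fun N ω => star (arnoldiVec (G N ω) (U N ω) i) ⬝ᵥ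
      (G N ω *ᵥ arnoldiVec (G N ω) (U N ω) j)) atTop fun _ => 0 := by
  have hm (N : ℕ) : Measurable fun z : (Fin N → ℂ) × Matrix (Fin N) (Fin N) ℂ =>
      star (arnoldiVec z.2 z.1 i) ⬝ᵥ (z.2 *ᵥ arnoldiVec z.2 z.1 j) := by fun_prop
  have hm' := fun N => (hm N).comp_aemeasurable
    ((hU N).prodMk (hG N).aemeasurable_and_map_eq.1)
  refine tendstoInMeasure_zero_of_lintegral_sq_le
    (C := arnoldiMomentBound i + arnoldiMomentBound j) hm' fun N hN => ?_
  have : NeZero N := ⟨by omega⟩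
  have h := lintegral_le_of_indepFun_ginibre (hG N) (hU N) (hU1 N) (hind N)
    (F := fun z => ENNReal.ofReal (‖star (arnoldiVec z.2 z.1 i) ⬝ᵥ
      (z.2 *ᵥ arnoldiVec z.2 z.1 j)‖ ^ 2))
    (by fun_prop) fun u hu => lintegral_norm_dotProduct_mulVec_arnoldiVec_sq_le hu hij
  exact h

lemma tendstoInMeasure_normSqSum_mulVec_arnoldiVec_sub (hG : ∀ N, IsGinibre P (G N))
    (hU : ∀ N, AEMeasurable (U N) P) (hU1 : ∀ N ω, normSqSum (U N ω) ≤ 1)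
    (hind : ∀ N, IndepFun (U N) (G N) P) (j : ℕ) :
    TendstoInMeasure P (fun N ω =>
      star (G N ω *ᵥ arnoldiVec (G N ω) (U N ω) j) ⬝ᵥ (G N ω *ᵥ arnoldiVec (G N ω) (U N ω) j) -
      star (arnoldiVec (G N ω) (U N ω) j) ⬝ᵥ arnoldiVec (G N ω) (U N ω) j) atTop fun _ => 0 := by
  simp only [star_dotProduct_self, ← Complex.ofReal_sub]
  have hm (N : ℕ) : Measurable fun z : (Fin N → ℂ) × Matrix (Fin N) (Fin N) ℂ =>
      ((normSqSum (z.2 *ᵥ arnoldiVec z.2 z.1 j) - normSqSum (arnoldiVec z.2 z.1 j) : ℝ) : ℂ) := by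
    fun_prop
  have hm' := fun N => (hm N).comp_aemeasurable
    ((hU N).prodMk (hG N).aemeasurable_and_map_eq.1)
  refine tendstoInMeasure_zero_of_lintegral_sq_le
    (C := gaussianSqVariance * arnoldiMomentBound j) hm' fun N hN => ?_
  have : NeZero N := ⟨by omega⟩
  simp only [Complex.norm_real, Real.norm_eq_abs, sq_abs]
  have h := lintegral_le_of_indepFun_ginibre (hG N) (hU N) (hU1 N) (hind N)
    (F := fun z => ENNReal.ofReal ((normSqSum (z.2 *ᵥ arnoldiVec z.2 z.1 j) -
      normSqSum (arnoldiVec z.2 z.1 j)) ^ 2))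
    (by fun_prop) fun u hu => lintegral_normSqSum_mulVec_arnoldiVec_sub_sq_le hu j
  exact h

/-- The norm limit is a hypothesis because this lemma serves inside the induction that proves it; it
keeps the denominator away from `0`. -/
lemma tendstoInMeasure_arnoldiCoeff_of_norm (hG : ∀ N, IsGinibre P (G N))
    (hU : ∀ N, AEMeasurable (U N) P) (hU1 : ∀ N ω, normSqSum (U N ω) ≤ 1)
    (hind : ∀ N, IndepFun (U N) (G N) P) {i j : ℕ} (hij : i ≤ j)
    (hi : TendstoInMeasure P (fun N ω => star (arnoldiVec (G N ω) (U N ω) i) ⬝ᵥ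
      arnoldiVec (G N ω) (U N ω) i) atTop fun _ => 1) :
    TendstoInMeasure P (fun N ω => arnoldiCoeff (G N ω) (U N ω) i j) atTop fun _ => 0 := by
  have h1 := hi.continuousAt_comp (f := fun z : ℂ => z⁻¹) (continuousAt_inv₀ one_ne_zero)
  simpa [arnoldiCoeff] using h1.mul_const_limit
    (tendstoInMeasure_dotProduct_mulVec_arnoldiVec hG hU hU1 hind hij)

/-- Strong induction: in the Pythagoras identity `‖G v_j‖²` has the limit of `‖v_j‖²`, and the
subtracted terms, which involve all `v_i` with `i ≤ j`, vanish in the limit. -/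
lemma tendstoInMeasure_star_arnoldiVec_dotProduct_self (hG : ∀ N, IsGinibre P (G N))
    (hU : ∀ N, AEMeasurable (U N) P) (hU1 : ∀ N ω, normSqSum (U N ω) ≤ 1)
    (hU1' : ∀ N, 1 ≤ N → ∀ᵐ ω ∂P, normSqSum (U N ω) = 1)
    (hind : ∀ N, IndepFun (U N) (G N) P) (j : ℕ) :
    TendstoInMeasure P (fun N ω => star (arnoldiVec (G N ω) (U N ω) j) ⬝ᵥ
      arnoldiVec (G N ω) (U N ω) j) atTop fun _ => 1 := by
  induction j using Nat.strong_induction_on with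
  | _ j ih =>
    cases j with
    | zero =>
      refine (tendstoInMeasure_const (1 : ℂ)).congr' ?_ (ae_eq_refl _)
      filter_upwards [eventually_ge_atTop 1] with N hN
      filter_upwards [hU1' N hN] with ω hω
      rw [arnoldiVec_zero, star_dotProduct_self, hω, Complex.ofReal_one]
    | succ j =>
      have h1 := (tendstoInMeasure_normSqSum_mulVec_arnoldiVec_sub hG hU hU1 hind j).add_const_limit
        (ih j (by omega))
      have h2 := tendstoInMeasure_sum (P := P) (Finset.range (j + 1))
        (X := fun i N ω => arnoldiCoeff (G N ω) (U N ω) i j *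
          star (star (arnoldiVec (G N ω) (U N ω) i) ⬝ᵥ (G N ω *ᵥ arnoldiVec (G N ω) (U N ω) j)))
        (c := fun _ => 0 * star 0) fun i hi =>
          have hij : i ≤ j := Nat.lt_succ_iff.1 (Finset.mem_range.1 hi)
          (tendstoInMeasure_arnoldiCoeff_of_norm hG hU hU1 hind hij
            (ih i (by omega))).mul_const_limit
            (tendstoInMeasure_dotProduct_mulVec_arnoldiVec hG hU hU1 hind hij).star_const_limit
      have h3 := h1.sub_const_limit h2
      simp only [sub_add_cancel, star_dotProduct_mulVec_arnoldiVec, add_sub_cancel_right] at h3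
      simpa using h3

lemma tendstoInMeasure_arnoldiCoeff (hG : ∀ N, IsGinibre P (G N))
    (hU : ∀ N, AEMeasurable (U N) P) (hU1 : ∀ N ω, normSqSum (U N ω) ≤ 1)
    (hU1' : ∀ N, 1 ≤ N → ∀ᵐ ω ∂P, normSqSum (U N ω) = 1)
    (hind : ∀ N, IndepFun (U N) (G N) P) {i j : ℕ} (hij : i ≤ j) :
    TendstoInMeasure P (fun N ω => arnoldiCoeff (G N ω) (U N ω) i j) atTop fun _ => 0 :=
  tendstoInMeasure_arnoldiCoeff_of_norm hG hU hU1 hind hij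
    (tendstoInMeasure_star_arnoldiVec_dotProduct_self hG hU hU1 hU1' hind i)

/-- In the limit the Hessenberg terms of the recursion disappear and only the shift remains. -/
lemma tendstoInMeasure_krylovCoeff (hG : ∀ N, IsGinibre P (G N))
    (hU : ∀ N, AEMeasurable (U N) P) (hU1 : ∀ N ω, normSqSum (U N ω) ≤ 1)
    (hU1' : ∀ N, 1 ≤ N → ∀ᵐ ω ∂P, normSqSum (U N ω) = 1)
    (hind : ∀ N, IndepFun (U N) (G N) P) (m i : ℕ) :
    TendstoInMeasure P (fun N ω => krylovCoeff (G N ω) (U N ω) m i) atTop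
      fun _ => if i = m then 1 else 0 := by
  induction m generalizing i with
  | zero => exact tendstoInMeasure_const _
  | succ m ih =>
    have h2 := tendstoInMeasure_sum (P := P) (Finset.range (m + 1))
      (X := fun l N ω => if i ≤ l then
        arnoldiCoeff (G N ω) (U N ω) i l * krylovCoeff (G N ω) (U N ω) m l else 0)
      (c := fun _ => 0) fun l _ => by
        by_cases hl : i ≤ l
        · simpa [hl] using (tendstoInMeasure_arnoldiCoeff hG hU hU1 hU1' hind hl).mul_const_limit
            (ih l)
        · simpa [hl] using tendstoInMeasure_const (P := P) (0 : ℂ)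
    simp only [Finset.sum_const_zero] at h2
    cases i with
    | zero =>
      simpa [krylovCoeff] using h2
    | succ i =>
      simpa [krylovCoeff] using (ih i).add_const_limit h2

/-- The Gram matrix of the Krylov vectors of a Ginibre matrix converges to the identity in
probability. -/
theorem tendstoInMeasure_krylov_gram (hG : ∀ N, IsGinibre P (G N))
    (hU : ∀ N, AEMeasurable (U N) P) (hU1 : ∀ N ω, normSqSum (U N ω) ≤ 1)
    (hU1' : ∀ N, 1 ≤ N → ∀ᵐ ω ∂P, normSqSum (U N ω) = 1)
    (hind : ∀ N, IndepFun (U N) (G N) P) (i j : ℕ) :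
    TendstoInMeasure P (fun N ω => star (G N ω ^ i *ᵥ U N ω) ⬝ᵥ (G N ω ^ j *ᵥ U N ω)) atTop
      fun _ => if i = j then 1 else 0 := by
  simp only [star_pow_mulVec_dotProduct]
  have hp (a b : ℕ) : TendstoInMeasure P (fun N ω => star (arnoldiVec (G N ω) (U N ω) a) ⬝ᵥ
      arnoldiVec (G N ω) (U N ω) b) atTop fun _ => if a = b then 1 else 0 := by
    by_cases hab : a = b
    · subst hab
      simpa using tendstoInMeasure_star_arnoldiVec_dotProduct_self hG hU hU1 hU1' hind a
    · simpa [hab, arnoldiVec_orthogonal] using tendstoInMeasure_const (P := P) (0 : ℂ)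
  have hc := tendstoInMeasure_krylovCoeff hG hU hU1 hU1' hind
  have h := tendstoInMeasure_sum (P := P) (Finset.range (i + 1)) fun a _ =>
    tendstoInMeasure_sum (P := P) (Finset.range (j + 1)) fun b _ =>
      ((hc i a).star_const_limit.mul_const_limit (hc j b)).mul_const_limit (hp a b)
  convert h using 2
  rw [Finset.sum_eq_single_of_mem i (by simp) fun a _ ha => by simp [ha],
    Finset.sum_eq_single_of_mem j (by simp) fun b _ hb => by simp [hb]]
  simp

end GinibreKrylov

/-! ### From the Gram matrix to the GMRES residual -/

section GMRES

lemma normSqSum_ofLp {N : ℕ} (x : EuclideanSpace ℂ (Fin N)) : normSqSum x.ofLp = ‖x‖ ^ 2 := by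
  rw [EuclideanSpace.norm_sq_eq, normSqSum]

lemma normSqSum_smul {n : Type*} [Fintype n] (c : ℂ) (x : n → ℂ) :
    normSqSum (c • x) = ‖c‖ ^ 2 * normSqSum x := by
  simp [normSqSum, mul_pow, Finset.mul_sum]

/-- The `c j` are the coefficients of `1 - X p` after the substitution `X ↦ 1 + σ X`. This sends
`-σ⁻¹` to `0`, where `1 - X p` equals `1`. -/
lemma exists_krylov_coeff_of_poly {N : ℕ} (G : Matrix (Fin N) (Fin N) ℂ) {σ : ℂ} (hσ : σ ≠ 0)
    {k : ℕ} {p : ℂ[X]} (hp : p.degree < (k : WithBot ℕ)) :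
    ∃ c : ℕ → ℂ, ∑ j ∈ Finset.range (k + 1), c j * (-σ⁻¹) ^ j = 1 ∧
      1 - (1 + σ • G) * Polynomial.aeval (1 + σ • G) p =
        ∑ j ∈ Finset.range (k + 1), c j • G ^ j := by
  set s : ℂ[X] := 1 + Polynomial.C σ * Polynomial.X with hs
  set r : ℂ[X] := (1 - Polynomial.X * p).comp s with hr
  have hs1 : s.natDegree ≤ 1 := by
    rw [hs]
    compute_degree
  have hp1 : (1 - Polynomial.X * p).natDegree ≤ k := by
    rw [Polynomial.natDegree_le_iff_coeff_eq_zero]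
    intro m hm
    obtain ⟨m, rfl⟩ : ∃ m', m = m' + 1 := ⟨m - 1, by omega⟩
    rw [Polynomial.coeff_sub, Polynomial.coeff_X_mul, Polynomial.coeff_one,
      Polynomial.degree_lt_iff_coeff_zero p k |>.1 hp m (by omega)]
    simp
  have hdeg : r.natDegree < k + 1 := by
    rw [Nat.lt_succ_iff]
    refine Polynomial.natDegree_comp_le.trans ?_
    calc _ ≤ k * 1 := Nat.mul_le_mul hp1 hs1
      _ = k := mul_one k
  have hsG : Polynomial.aeval G s = 1 + σ • G := by
    simp [hs, Algebra.smul_def]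
  refine ⟨r.coeff, ?_, ?_⟩
  · rw [← Polynomial.eval_eq_sum_range' hdeg, hr, Polynomial.eval_comp]
    simp [hs, hσ]
  · rw [← Polynomial.aeval_eq_sum_range' hdeg, hr, Polynomial.aeval_comp, hsG]
    simp

/-- The inverse substitution `X ↦ σ⁻¹ (X - 1)` gives a polynomial `q` whose constant term is `1` by
the constraint, so `q = 1 - X p` with `p = -q.divX`. -/
lemma exists_poly_of_krylov_coeff {N : ℕ} (G : Matrix (Fin N) (Fin N) ℂ) {σ : ℂ} (hσ : σ ≠ 0)
    {k : ℕ} {c : ℕ → ℂ} (hc : ∑ j ∈ Finset.range (k + 1), c j * (-σ⁻¹) ^ j = 1) :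
    ∃ p : ℂ[X], p.degree < (k : WithBot ℕ) ∧
      1 - (1 + σ • G) * Polynomial.aeval (1 + σ • G) p =
        ∑ j ∈ Finset.range (k + 1), c j • G ^ j := by
  set s : ℂ[X] := Polynomial.C σ⁻¹ * (Polynomial.X - 1) with hs
  set r : ℂ[X] := ∑ j ∈ Finset.range (k + 1), Polynomial.C (c j) * Polynomial.X ^ j with hr
  set q : ℂ[X] := r.comp s with hq
  have hs1 : s.natDegree ≤ 1 := by
    rw [hs]
    compute_degree
  have hr1 : r.natDegree ≤ k := Polynomial.natDegree_sum_le_of_forall_le _ _ fun j hj =>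
    (Polynomial.natDegree_C_mul_X_pow_le _ _).trans (Nat.lt_succ_iff.1 (Finset.mem_range.1 hj))
  have hdeg : q.natDegree ≤ k := by
    refine Polynomial.natDegree_comp_le.trans ?_
    calc _ ≤ k * 1 := Nat.mul_le_mul hr1 hs1
      _ = k := mul_one k
  have hq0 : q.coeff 0 = 1 := by
    rw [Polynomial.coeff_zero_eq_eval_zero, hq, Polynomial.eval_comp, hr,
      Polynomial.eval_finsetSum, ← hc]
    simp [hs]
  have hsA : Polynomial.aeval (1 + σ • G) s = G := by
    rw [hs, map_mul, Polynomial.aeval_C, map_sub, Polynomial.aeval_X, map_one,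
      add_sub_cancel_left, ← Algebra.smul_def, smul_smul, inv_mul_cancel₀ hσ, one_smul]
  refine ⟨-q.divX, ?_, ?_⟩
  · rw [Polynomial.degree_neg, Polynomial.degree_lt_iff_coeff_zero]
    intro m hm
    rw [Polynomial.coeff_divX]
    exact Polynomial.coeff_eq_zero_of_natDegree_lt (by omega)
  · have h1 : Polynomial.aeval (1 + σ • G) q = ∑ j ∈ Finset.range (k + 1), c j • G ^ j := by
      rw [hq, Polynomial.aeval_comp, hsA, hr]
      simp [Algebra.smul_def]
    rw [← h1]
    conv_rhs => rw [← Polynomial.X_mul_divX_add q, hq0]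
    simp
    abel

/-- The difference is the quadratic form of the Gram matrix minus the identity, and `|c_i| |c_j| ≤ ∑
|c_l|²`. -/
lemma abs_normSqSum_sum_sub_le {n : Type*} [Fintype n] (s : Finset ℕ) (c : ℕ → ℂ)
    (v : ℕ → n → ℂ) :
    |normSqSum (∑ j ∈ s, c j • v j) - ∑ j ∈ s, ‖c j‖ ^ 2| ≤
      (∑ i ∈ s, ∑ j ∈ s, ‖star (v i) ⬝ᵥ v j - if i = j then 1 else 0‖) *
        ∑ j ∈ s, ‖c j‖ ^ 2 := by
  have h1 : ((normSqSum (∑ j ∈ s, c j • v j) - ∑ j ∈ s, ‖c j‖ ^ 2 : ℝ) : ℂ) =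
      ∑ i ∈ s, ∑ j ∈ s, star (c i) * c j * (star (v i) ⬝ᵥ v j - if i = j then 1 else 0) := by
    rw [Complex.ofReal_sub, ← star_dotProduct_self, star_sum, sum_dotProduct]
    simp only [mul_sub, Finset.sum_sub_distrib, dotProduct_sum, star_smul, smul_dotProduct,
      dotProduct_smul, smul_eq_mul]
    congr 1
    · refine Finset.sum_congr rfl fun i _ => Finset.sum_congr rfl fun j _ => ?_
      ring
    · rw [Complex.ofReal_sum]
      refine Finset.sum_congr rfl fun i hi => ?_
      simp [hi, Complex.conj_mul']
  have h2 : ∀ i ∈ s, ‖c i‖ ^ 2 ≤ ∑ j ∈ s, ‖c j‖ ^ 2 := fun i hi =>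
    Finset.single_le_sum (f := fun j => ‖c j‖ ^ 2) (fun _ _ => by positivity) hi
  rw [← Real.norm_eq_abs, ← Complex.norm_real, h1, Finset.sum_mul]
  refine (norm_sum_le _ _).trans (Finset.sum_le_sum fun i hi => ?_)
  rw [Finset.sum_mul]
  refine (norm_sum_le _ _).trans (Finset.sum_le_sum fun j hj => ?_)
  rw [norm_mul, norm_mul, norm_star, mul_comm]
  refine mul_le_mul_of_nonneg_left ?_ (norm_nonneg _)
  nlinarith [h2 i hi, h2 j hj, sq_nonneg (‖c i‖ - ‖c j‖)]

lemma one_le_sum_mul_sum_of_sum_mul_eq_one {s : Finset ℕ} {c : ℕ → ℂ} {t : ℝ}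
    (hc : ∑ j ∈ s, c j * (t : ℂ) ^ j = 1) :
    1 ≤ (∑ j ∈ s, ‖c j‖ ^ 2) * ∑ j ∈ s, (t ^ 2) ^ j := by
  have h1 : 1 ≤ ∑ j ∈ s, ‖c j‖ * |t| ^ j := by
    have := norm_sum_le s fun j => c j * (t : ℂ) ^ j
    rw [hc, norm_one] at this
    simpa using this
  have h2 := Finset.sum_mul_sq_le_sq_mul_sq s (fun j => ‖c j‖) fun j => |t| ^ j
  have h3 : ∀ j, (|t| ^ j) ^ 2 = (t ^ 2) ^ j := fun j => by
    rw [← pow_mul, mul_comm, pow_mul, sq_abs]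
  simp only [h3] at h2
  exact (one_le_pow₀ h1).trans h2

/-- The squared relative GMRES residual is determined by the Gram matrix of the Krylov vectors, up
to the distance of the latter from the identity. -/
lemma abs_gmresResidualNorm_sq_sub_le {N : ℕ} (G : Matrix (Fin N) (Fin N) ℂ)
    {b : EuclideanSpace ℂ (Fin N)} (hb : b ≠ 0) {σ : ℝ} (hσ : σ ≠ 0) (k : ℕ) :
    |(gmresResidualNorm (1 + (σ : ℂ) • G) b k / ‖b‖) ^ 2 -
        (∑ j ∈ Finset.range (k + 1), ((-σ⁻¹) ^ 2) ^ j)⁻¹| ≤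
      ∑ i ∈ Finset.range (k + 1), ∑ j ∈ Finset.range (k + 1),
        ‖star (G ^ i *ᵥ ((‖b‖ : ℂ)⁻¹ • b.ofLp)) ⬝ᵥ (G ^ j *ᵥ ((‖b‖ : ℂ)⁻¹ • b.ofLp)) -
          if i = j then 1 else 0‖ := by
  have hσ' : (σ : ℂ) ≠ 0 := by exact_mod_cast hσ
  have hb' : 0 < ‖b‖ := norm_pos_iff.2 hb
  set u : Fin N → ℂ := (‖b‖ : ℂ)⁻¹ • b.ofLp with hu
  set η := ∑ i ∈ Finset.range (k + 1), ∑ j ∈ Finset.range (k + 1),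
        ‖star (G ^ i *ᵥ u) ⬝ᵥ (G ^ j *ᵥ u) - if i = j then 1 else 0‖ with hη
  have hη0 : 0 ≤ η := Finset.sum_nonneg fun _ _ => Finset.sum_nonneg fun _ _ => norm_nonneg _
  set t : ℝ := -σ⁻¹ with ht
  have htc : (t : ℂ) = -(σ : ℂ)⁻¹ := by simp [ht]
  set S := ∑ j ∈ Finset.range (k + 1), (t ^ 2) ^ j with hS
  have hS1 : 1 ≤ S := by
    have := Finset.single_le_sum (s := Finset.range (k + 1)) (f := fun j => (t ^ 2) ^ j)
      (fun j _ => by positivity) (Finset.mem_range.2 (Nat.succ_pos k))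
    simpa using this
  have hS0 : 0 < S := by linarith
  have hres (p : ℂ[X]) (c : ℕ → ℂ)
      (h : 1 - (1 + (σ : ℂ) • G) * Polynomial.aeval (1 + (σ : ℂ) • G) p =
        ∑ j ∈ Finset.range (k + 1), c j • G ^ j) :
      (‖b - WithLp.toLp 2 ((1 + (σ : ℂ) • G) *ᵥ
        (Polynomial.aeval (1 + (σ : ℂ) • G) p *ᵥ b.ofLp))‖ / ‖b‖) ^ 2 =
        normSqSum (∑ j ∈ Finset.range (k + 1), c j • (G ^ j *ᵥ u)) := by
    have e1 : ∑ j ∈ Finset.range (k + 1), c j • (G ^ j *ᵥ u) =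
        (‖b‖ : ℂ)⁻¹ • (b - WithLp.toLp 2 ((1 + (σ : ℂ) • G) *ᵥ
        (Polynomial.aeval (1 + (σ : ℂ) • G) p *ᵥ b.ofLp))).ofLp := by
      rw [WithLp.ofLp_sub, WithLp.ofLp_toLp, Matrix.mulVec_mulVec,
        show b.ofLp - ((1 + (σ : ℂ) • G) * Polynomial.aeval (1 + (σ : ℂ) • G) p) *ᵥ b.ofLp =
          (1 - (1 + (σ : ℂ) • G) * Polynomial.aeval (1 + (σ : ℂ) • G) p) *ᵥ b.ofLp by
          rw [Matrix.sub_mulVec, Matrix.one_mulVec], h, Matrix.sum_mulVec, Finset.smul_sum]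
      refine Finset.sum_congr rfl fun j _ => ?_
      rw [hu, Matrix.mulVec_smul, Matrix.smul_mulVec, smul_comm]
    rw [e1, normSqSum_smul, normSqSum_ofLp, norm_inv, Complex.norm_real, norm_norm,
      div_eq_inv_mul, mul_pow]
  have hmain (c : ℕ → ℂ) := abs_le.1 (abs_normSqSum_sum_sub_le (Finset.range (k + 1)) c
    fun j => G ^ j *ᵥ u)
  simp only [← hη] at hmain
  have hleast := gmresResidualNorm_isLeast (1 + (σ : ℂ) • G) b k
  set ρ := gmresResidualNorm (1 + (σ : ℂ) • G) b k with hρ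
  have hSinv : S⁻¹ ≤ 1 := inv_le_one_of_one_le₀ hS1
  have hSinv0 : 0 < S⁻¹ := inv_pos.2 hS0
  have hηS : η * S⁻¹ ≤ η := mul_le_of_le_one_right hη0 hSinv
  obtain ⟨⟨p, hp, hpρ⟩, hmin⟩ := hleast
  rw [abs_le]
  constructor
  · obtain ⟨c, hc1, hc2⟩ := exists_krylov_coeff_of_poly G hσ' hp
    have h1 := hres p c hc2
    rw [← hpρ] at h1
    rw [← htc] at hc1
    have h2 : S⁻¹ ≤ ∑ j ∈ Finset.range (k + 1), ‖c j‖ ^ 2 := by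
      rw [inv_le_iff_one_le_mul₀ hS0]
      exact one_le_sum_mul_sum_of_sum_mul_eq_one hc1
    have h3 := (hmain c).1
    rw [← h1] at h3
    -- If `η ≤ 1`, the squared residual is at least `(1 - η) S⁻¹ ≥ S⁻¹ - η`. Otherwise `S⁻¹ - η < 0`
    -- and there is nothing to prove; the Gram matrix need not be invertible.
    by_cases hη1 : η ≤ 1
    · nlinarith [mul_le_mul_of_nonneg_left h2 (sub_nonneg.2 hη1)]
    · nlinarith [sq_nonneg (ρ / ‖b‖)]
  -- The equality case of Cauchy–Schwarz, `c_j = S⁻¹ t^j`, supplies a competitor.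
  · have hcs : ∑ j ∈ Finset.range (k + 1), ((S⁻¹ * t ^ j : ℝ) : ℂ) * (-(σ : ℂ)⁻¹) ^ j = 1 := by
      rw [← htc]
      have : ∑ j ∈ Finset.range (k + 1), (S⁻¹ * t ^ j) * t ^ j = 1 := by
        rw [← inv_mul_cancel₀ hS0.ne', hS, Finset.mul_sum]
        refine Finset.sum_congr rfl fun j _ => ?_
        rw [← pow_mul, mul_comm 2 j, pow_mul]
        ring
      exact_mod_cast this
    obtain ⟨q, hq1, hq2⟩ := exists_poly_of_krylov_coeff G hσ' hcs
    have h1 := hres q _ hq2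
    have h2 := hmin ⟨q, hq1, rfl⟩
    have hρ0 : 0 ≤ ρ := by rw [hpρ]; exact norm_nonneg _
    have h3 : (ρ / ‖b‖) ^ 2 ≤ normSqSum (∑ j ∈ Finset.range (k + 1),
        ((S⁻¹ * t ^ j : ℝ) : ℂ) • (G ^ j *ᵥ u)) := by
      rw [← h1]
      gcongr
    have h4 : ∑ j ∈ Finset.range (k + 1), ‖((S⁻¹ * t ^ j : ℝ) : ℂ)‖ ^ 2 = S⁻¹ := by
      have e (j : ℕ) : ‖((S⁻¹ * t ^ j : ℝ) : ℂ)‖ ^ 2 = S⁻¹ ^ 2 * (t ^ 2) ^ j := by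
        rw [Complex.norm_real, Real.norm_eq_abs, sq_abs, mul_pow, ← pow_mul, mul_comm j 2, pow_mul]
      simp only [e]
      rw [← Finset.mul_sum, ← hS, sq, mul_assoc, inv_mul_cancel₀ hS0.ne', mul_one]
    have h5 := (hmain fun j => ((S⁻¹ * t ^ j : ℝ) : ℂ)).2
    rw [h4] at h5
    linarith

lemma sqrt_inv_sum_eq {σ : ℝ} (hσ : σ ∈ Set.Ioo (0 : ℝ) 1) (k : ℕ) :
    √(∑ j ∈ Finset.range (k + 1), ((-σ⁻¹) ^ 2) ^ j)⁻¹ =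
      √((1 - σ ^ 2) / (1 - σ ^ (2 + 2 * k))) * σ ^ k := by
  obtain ⟨h0, h1⟩ := hσ
  have hk : 0 ≤ σ ^ k := by positivity
  have hlt : σ ^ (2 + 2 * k) < 1 := pow_lt_one₀ h0.le h1 (by omega)
  have hlt2 : σ ^ 2 < 1 := pow_lt_one₀ h0.le h1 (by omega)
  have hne : (-σ⁻¹) ^ 2 ≠ 1 := by
    rw [neg_sq, inv_pow]
    exact fun h => hlt2.ne (inv_eq_one.1 h)
  rw [← Real.sqrt_sq hk, ← Real.sqrt_mul (div_nonneg (by linarith) (by linarith))]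
  congr 1
  rw [geom_sum_eq hne, inv_div, neg_sq, inv_pow, inv_pow]
  have e : σ ^ (2 + 2 * k) = (σ ^ 2) ^ (k + 1) := by rw [← pow_mul]; ring_nf
  have e2 : (σ ^ k) ^ 2 = (σ ^ 2) ^ k := by rw [← pow_mul, ← pow_mul, mul_comm]
  have h3 : (σ ^ 2) ^ (k + 1) < 1 := e ▸ hlt
  rw [e, e2]
  have hpos : 0 < σ ^ 2 := by positivity
  generalize σ ^ 2 = x at *
  have hx : (x ^ (k + 1))⁻¹ - 1 ≠ 0 := by
    rw [sub_ne_zero]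
    exact fun h => h3.ne (inv_eq_one.1 h)
  have hx2 : 1 - x ^ (k + 1) ≠ 0 := by linarith
  rw [div_eq_iff hx]
  field_simp
  ring

end GMRES

/-! ### The limit of the relative residual -/

theorem mainTheorem1 {Ω : Type*} [MeasurableSpace Ω] (P : Measure Ω) [IsProbabilityMeasure P]
    (G : (N : ℕ) → Ω → Matrix (Fin N) (Fin N) ℂ) (hG : ∀ N, IsGinibre P (G N))
    (b : (N : ℕ) → Ω → EuclideanSpace ℂ (Fin N)) (hb : ∀ N, AEMeasurable (b N) P)
    (hb0 : ∀ N, 1 ≤ N → ∀ᵐ ω ∂P, b N ω ≠ 0)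
    (hind : ∀ N, IndepFun (b N) (fun ω i j => G N ω i j) P)
    (σ : ℝ) (hσ : σ ∈ Set.Ioo (0 : ℝ) 1) (k : ℕ) :
    TendstoInMeasure P
      (fun N ω => gmresResidualNorm (1 + (σ : ℂ) • G N ω) (b N ω) k / ‖b N ω‖)
      atTop
      (fun _ => √((1 - σ ^ 2) / (1 - σ ^ (2 + 2 * k))) * σ ^ k) := by
  let φ (N : ℕ) (x : EuclideanSpace ℂ (Fin N)) : Fin N → ℂ := (‖x‖ : ℂ)⁻¹ • x.ofLp
  have hφ (N : ℕ) : Measurable (φ N) := by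
    refine measurable_pi_iff.2 fun i => ?_
    have h : Measurable fun x : EuclideanSpace ℂ (Fin N) => x.ofLp i :=
      Continuous.measurable (by fun_prop)
    exact (Complex.measurable_ofReal.comp measurable_norm).inv.mul h
  let U (N : ℕ) (ω : Ω) : Fin N → ℂ := φ N (b N ω)
  have hnorm (N : ℕ) (ω : Ω) : normSqSum (U N ω) = (‖b N ω‖⁻¹ * ‖b N ω‖) ^ 2 := by
    change normSqSum ((‖b N ω‖ : ℂ)⁻¹ • (b N ω).ofLp) = _
    rw [normSqSum_smul, normSqSum_ofLp, norm_inv, Complex.norm_real, norm_norm, mul_pow]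
  have hU (N : ℕ) : AEMeasurable (U N) P := (hφ N).comp_aemeasurable (hb N)
  -- Where `b = 0` the normalised vector is `0`, so the inequality holds for every `ω`, whereas
  -- equality holds only almost surely and for `1 ≤ N`.
  have hU1 (N : ℕ) (ω : Ω) : normSqSum (U N ω) ≤ 1 := by
    rw [hnorm]
    exact pow_le_one₀ (by positivity) inv_mul_le_one
  have hU1' (N : ℕ) (hN : 1 ≤ N) : ∀ᵐ ω ∂P, normSqSum (U N ω) = 1 := by
    filter_upwards [hb0 N hN] with ω hω
    rw [hnorm, inv_mul_cancel₀ (norm_ne_zero_iff.2 hω), one_pow]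
  have hind' (N : ℕ) : IndepFun (U N) (G N) P := (hind N).comp (hφ N) measurable_id
  have hgram := tendstoInMeasure_krylov_gram hG hU hU1 hU1' hind'
  have herr := tendstoInMeasure_sum (P := P) (Finset.range (k + 1)) fun i _ =>
    tendstoInMeasure_sum (P := P) (Finset.range (k + 1)) fun j _ =>
      (hgram i j).continuousAt_comp
        (f := fun z : ℂ => ((‖z - if i = j then 1 else 0‖ : ℝ) : ℂ)) (by fun_prop)
  simp only [sub_self, norm_zero, Complex.ofReal_zero, Finset.sum_const_zero] at herr
  have hsq : TendstoInMeasure P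
      (fun N ω => (gmresResidualNorm (1 + (σ : ℂ) • G N ω) (b N ω) k / ‖b N ω‖) ^ 2) atTop
      (fun _ => (∑ j ∈ Finset.range (k + 1), ((-σ⁻¹) ^ 2) ^ j)⁻¹) := by
    rw [tendstoInMeasure_iff_dist] at herr ⊢
    intro ε hε
    refine tendsto_of_tendsto_of_tendsto_of_le_of_le' tendsto_const_nhds (herr ε hε)
      (Eventually.of_forall fun _ => zero_le) ?_
    filter_upwards [eventually_ge_atTop 1] with N hN
    refine measure_mono_ae ?_
    filter_upwards [hb0 N hN] with ω hω h
    refine (le_trans h (abs_gmresResidualNorm_sq_sub_le (G N ω) hω hσ.1.ne' k)).trans ?_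
    simp only [dist_zero_right, ← Complex.ofReal_sum, Complex.norm_real]
    exact le_abs_self _
  -- The Gram estimate concerns squares; as the ratio is nonnegative, taking the root recovers it.
  have hfin := hsq.continuousAt_comp (f := Real.sqrt) Real.continuous_sqrt.continuousAt
  rw [sqrt_inv_sum_eq hσ] at hfin
  refine hfin.congr_left fun N => ae_of_all _ fun ω => Real.sqrt_sq (div_nonneg ?_ (norm_nonneg _))
  obtain ⟨p, -, hp⟩ := (gmresResidualNorm_isLeast (1 + (σ : ℂ) • G N ω) (b N ω) k).1
  rw [hp]
  exact norm_nonneg _
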